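/- Let $n\ge 1$, and let $b\in C^1([0,\infty))$ be an increasing function such that $b\ge b_0$ and $b'\ge b_0'$ on $[0,\infty)$ for some constants $b_0>0$, $b_0'>0$. Let $s\in\mathbb R$ and $(u_0,u_1)\in H^s(\mathbb R^n)\times H^{s-1}(\mathbb R^n)$, and consider the Cauchy problem $$\partial_t^2u-\Delta_xu+\frac{b'(t)}{b(t)}\,\partial_tu=0,\qquad u(0,\cdot)=u_0,\quad \partial_tu(0,\cdot)=u_1. \tag{1}$$ Definitions. (a) A net $(b_\varepsilon)_{\varepsilon\in(0,1]}\subset C^\infty(\mathbb R)$ is *$C^\infty$-moderate* if for every compact $K\subset\mathbb R$ and $\alpha\in\mathbb N_0$ there are $N\in\mathbb N_0$ and $c>0$ with $\sup_{t\in K}|\partial^\alpha b_\varepsilon(t)|\le c\,\varepsilon^{-N-\alpha}$ for all $\varepsilon\in(0,1]$. A *$C^\infty$-moderate regularisation* of $b$ is a $C^\infty$-moderate net of the form $b_\varepsilon=B*\psi_{\omega(\varepsilon)}$, $\psi_h(t)=h^{-1}\psi(t/h)$, where $\psi\in C_0^\infty(\mathbb R)$, $\psi\ge0$, $\int\psi=1$;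 $\omega(\varepsilon)>0$ and $\omega(\varepsilon)\to0$ as $\varepsilon\to0$; and $B\in C^1(\mathbb R)$ is an extension of $b$ that is bounded below by a positive constant. (b) A net $(u_\varepsilon)_{\varepsilon\in(0,1]}$ is a *very weak solution of order $s$* of (1) with regularising family $(b_\varepsilon)_\varepsilon$ if $(b_\varepsilon)_\varepsilon$ is a $C^\infty$-moderate regularisation of $b$; if for every $\varepsilon\in(0,1]$ we have $u_\varepsilon\in C^k([0,\infty);H^{s-k})$ for all $k\in\mathbb N_0$ and $$\partial_t^2u_\varepsilon-\Delta_xu_\varepsilon+\frac{b_\varepsilon'(t)}{b_\varepsilon(t)}\,\partial_tu_\varepsilon=0\ \text{ on }[0,\infty)\times\mathbb R^n,\qquad u_\varepsilon(0,\cdot)=u_0,\quad\partial_tu_\varepsilon(0,\cdot)=u_1;$$ and if there is $N\in\mathbb N_0$ and for every $k\in\mathbb N_0$ a constant $c_k>0$ such that $\|\partial_t^ku_\varepsilon(t,\cdot)\|_{H^{s-k}}\le c_k\varepsilon^{-N-k}$ for all $t\in[0,\infty)$ and $\varepsilon\in(0,1]$. (c) A *classical (Sobolev) solution* of (1) on $[0,T]$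 is a function $\tilde u\in C([0,T];H^s)\cap C^1([0,T];H^{s-1})$ with the given initial data that satisfies the equation in the sense of distributions: for every Schwartz function $\varphi$, $t\mapsto\langle\partial_t\tilde u(t),\varphi\rangle$ is differentiable on $[0,T]$ with derivative $\langle\Delta_x\tilde u(t)-\frac{b'(t)}{b(t)}\partial_t\tilde u(t),\varphi\rangle$. **Theorem.** For every $T>0$ the problem (1) has a unique classical (Sobolev) solution $\tilde u$ on $[0,T]$, and for every $C^\infty$-moderate regularisation $(b_\varepsilon)_\varepsilon$ of $b$ and every very weak solution $(u_\varepsilon)_\varepsilon$ of order $s$ of (1) with regularising family $(b_\varepsilon)_\varepsilon$, $$u_\varepsilon\to\tilde u\quad\text{in } C([0,T];H^s)\cap C^1([0,T];H^{s-1})\qquad\text{as }\varepsilon\to0.$$ -/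

import Mathlib

open MeasureTheory Set Filter Topology TemperedDistribution
open scoped SchwartzMap ContDiff Laplacian Convolution

noncomputable section

namespace DissipativeWave

/-- Tempered distributions on `ℝⁿ`. -/
abbrev TempDist (n : ℕ) : Type := 𝓢'(EuclideanSpace ℝ (Fin n), ℂ)

/-- `H^r(ℝⁿ)` as a linear subspace of the tempered distributions (Mathlib's `MemSobolev`, `p = 2`). -/
def sobolevSubmodule (n : ℕ) (r : ℝ) : Submodule ℂ (TempDist n) where
  carrier := {f | MemSobolev r 2 f}
  add_mem' hf hg := MemSobolev.add hf hg
  zero_mem' := memSobolev_fun_zero _ _ r 2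
  smul_mem' c _ hf := MemSobolev.smul c hf

/-- The Sobolev space `H^r(ℝⁿ)`. It is a type of its own, so that it carries the topology of its
norm and not the one induced from the tempered distributions. -/
def SobolevSpace (n : ℕ) (r : ℝ) : Type := ↥(sobolevSubmodule n r)

namespace SobolevSpace

variable {n : ℕ} {r : ℝ}

instance : AddCommGroup (SobolevSpace n r) := inferInstanceAs (AddCommGroup ↥(sobolevSubmodule n r))

instance : Module ℂ (SobolevSpace n r) := inferInstanceAs (Module ℂ ↥(sobolevSubmodule n r))

/-- The inclusion of `H^r(ℝⁿ)` into the tempered distributions. -/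
def toDist : SobolevSpace n r →ₗ[ℂ] TempDist n := (sobolevSubmodule n r).subtype

theorem toDist_injective : Function.Injective (toDist (n := n) (r := r)) :=
  Subtype.val_injective

theorem memSobolev_toDist (f : SobolevSpace n r) : MemSobolev r 2 (toDist f) := f.2

theorem coe_Lp_injective {f g : Lp ℂ 2 (volume : Measure (EuclideanSpace ℝ (Fin n)))}
    (h : (f : TempDist n) = (g : TempDist n)) : f = g := by
  have hk := Lp.ker_toTemperedDistributionCLM_eq_bot (E := EuclideanSpace ℝ (Fin n)) (F := ℂ)
    (μ := volume) (p := 2)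
  exact LinearMap.ker_eq_bot.mp hk h

/-- The `L²` function representing the Bessel potential of order `r` of an element of `H^r`. -/
def besselLp (f : SobolevSpace n r) : Lp ℂ 2 (volume : Measure (EuclideanSpace ℝ (Fin n))) :=
  (memSobolev_toDist f).choose

theorem besselLp_spec (f : SobolevSpace n r) :
    besselPotential (EuclideanSpace ℝ (Fin n)) ℂ r (toDist f) = (besselLp f : TempDist n) :=
  (memSobolev_toDist f).choose_spec

/-- `besselLp` as a linear map. -/
def besselLpₗ : SobolevSpace n r →ₗ[ℂ]
    Lp ℂ 2 (volume : Measure (EuclideanSpace ℝ (Fin n))) where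
  toFun := besselLp
  map_add' f g := coe_Lp_injective (by
    rw [← besselLp_spec, ← Lp.toTemperedDistributionCLM_apply, map_add, map_add, map_add,
      besselLp_spec, besselLp_spec, Lp.toTemperedDistributionCLM_apply,
      Lp.toTemperedDistributionCLM_apply])
  map_smul' c f := coe_Lp_injective (by
    rw [← besselLp_spec, ← Lp.toTemperedDistributionCLM_apply, map_smul, map_smul, RingHom.id_apply,
      map_smul, besselLp_spec, Lp.toTemperedDistributionCLM_apply])

theorem besselLpₗ_injective : Function.Injective (besselLpₗ (n := n) (r := r)) := by
  intro f g h
  apply toDist_injective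
  have h' : besselLp f = besselLp g := h
  have h2 := besselLp_spec f
  rw [h', ← besselLp_spec g] at h2
  have h3 := congrArg (besselPotential (EuclideanSpace ℝ (Fin n)) ℂ (-r)) h2
  simpa using h3

/-- The norm `‖f‖_{H^r} = ‖J^r f‖_{L²}`, where `J^r` is the Bessel potential operator of order `r`. -/
instance : NormedAddCommGroup (SobolevSpace n r) :=
  NormedAddCommGroup.induced _ _ (besselLpₗ (n := n) (r := r)) besselLpₗ_injective

instance : NormedSpace ℂ (SobolevSpace n r) :=
  NormedSpace.induced ℂ (SobolevSpace n r) _ (besselLpₗ (n := n) (r := r))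

end SobolevSpace

open Classical in
/-- A tempered distribution that lies in `H^r`, seen as an element of `H^r`
(and `0` for a distribution outside `H^r`). -/
def toSobolev {n : ℕ} (r : ℝ) (f : TempDist n) : SobolevSpace n r :=
  if h : MemSobolev r 2 f then ⟨f, h⟩ else 0

/-- `u ∈ C^k(I; H^r)` for a time interval `I`. -/
def MemCk {n : ℕ} (k : ℕ) (r : ℝ) (I : Set ℝ) (u : ℝ → TempDist n) : Prop :=
  (∀ t ∈ I, MemSobolev r 2 (u t)) ∧ ContDiffOn ℝ k (fun t => toSobolev r (u t)) I

/-- The time derivative `∂_t^k u(t)` of `u ∈ C^k(I; H^r)`, an element of `H^r`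
(one-sided at the end points of `I`). -/
def timeDeriv {n : ℕ} (k : ℕ) (r : ℝ) (I : Set ℝ) (u : ℝ → TempDist n) (t : ℝ) :
    SobolevSpace n r :=
  iteratedDerivWithin k (fun τ => toSobolev r (u τ)) I t

/-- `u ∈ C(I; H^s) ∩ C¹(I; H^{s-1})` is a Sobolev solution, on the time interval `I ∋ 0`, of
`∂_t² u - Δ u + a(t) ∂_t u = 0`, `u(0) = u₀`, `∂_t u(0) = u₁`. For every `t ∈ I` the equation holds
in the sense of tempered distributions on `ℝⁿ`: for every Schwartz function `φ`, the function
`⟨∂_t u(t), φ⟩` of `t ∈ I` is differentiable with derivative `⟨Δ u(t) - a(t) ∂_t u(t), φ⟩`. -/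
structure IsSobolevSolution {n : ℕ} (I : Set ℝ) (a : ℝ → ℝ) (s : ℝ) (u₀ u₁ : TempDist n)
    (u : ℝ → TempDist n) : Prop where
  memC0 : MemCk 0 s I u
  memC1 : MemCk 1 (s - 1) I u
  equation : ∀ t ∈ I, ∀ φ : 𝓢(EuclideanSpace ℝ (Fin n), ℂ),
    HasDerivWithinAt (fun τ => SobolevSpace.toDist (timeDeriv 1 (s - 1) I u τ) φ)
      (Δ (u t) φ - (a t : ℂ) * SobolevSpace.toDist (timeDeriv 1 (s - 1) I u t) φ) I t
  initial : u 0 = u₀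
  initial_deriv : SobolevSpace.toDist (timeDeriv 1 (s - 1) I u 0) = u₁

/-- A net of smooth functions on `ℝ` is `C^∞`-moderate. -/
def IsModerate (f : ℝ → ℝ → ℝ) : Prop :=
  (∀ ε ∈ Ioc (0 : ℝ) 1, ContDiff ℝ ∞ (f ε)) ∧
  ∀ K : Set ℝ, IsCompact K → ∀ α : ℕ, ∃ N : ℕ, ∃ c : ℝ, 0 < c ∧
    ∀ ε ∈ Ioc (0 : ℝ) 1, ∀ t ∈ K, |iteratedDeriv α (f ε) t| ≤ c * (ε ^ (N + α))⁻¹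

/-- A net `(u_ε)` with `u_ε ∈ C^k([0,∞); H^{s-k})` for all `k` is `C^∞([0,∞); H^s)`-moderate. -/
def IsSobolevModerate {n : ℕ} (s : ℝ) (u : ℝ → ℝ → TempDist n) : Prop :=
  (∀ ε ∈ Ioc (0 : ℝ) 1, ∀ k : ℕ, MemCk k (s - k) (Ici 0) (u ε)) ∧
  ∃ N : ℕ, ∀ k : ℕ, ∃ c : ℝ, 0 < c ∧
    ∀ ε ∈ Ioc (0 : ℝ) 1, ∀ t ∈ Ici (0 : ℝ),
      ‖timeDeriv k (s - k) (Ici 0) (u ε) t‖ ≤ c * (ε ^ (N + k))⁻¹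

/-- Friedrichs mollifiers on `ℝ`. -/
structure IsMollifier (ψ : ℝ → ℝ) : Prop where
  smooth : ContDiff ℝ ∞ ψ
  compactSupport : HasCompactSupport ψ
  nonneg : ∀ t, 0 ≤ ψ t
  integral_eq_one : ∫ t, ψ t = 1

/-- The net `(b_ε)` is a `C^∞`-moderate regularisation of `b ∈ C¹([0,∞))`: it is `C^∞`-moderate and
`b_ε = B * ψ_{η(ε)}` with `ψ_h(t) = h⁻¹ ψ(t / h)`, for a Friedrichs mollifier `ψ`, positive scales
`η(ε) → 0` and an extension `B` of `b` to a `C¹` function on `ℝ` with a positive lower bound. -/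
def IsModerateRegularisation (b : ℝ → ℝ) (bε : ℝ → ℝ → ℝ) : Prop :=
  IsModerate bε ∧
  ∃ (B ψ η : ℝ → ℝ),
    ContDiff ℝ 1 B ∧ EqOn B b (Ici 0) ∧ (∃ c : ℝ, 0 < c ∧ ∀ t, c ≤ B t) ∧
    IsMollifier ψ ∧
    (∀ ε ∈ Ioc (0 : ℝ) 1, 0 < η ε) ∧ Tendsto η (𝓝[>] 0) (𝓝 0) ∧
    ∀ ε ∈ Ioc (0 : ℝ) 1,
      bε ε = B ⋆[ContinuousLinearMap.mul ℝ ℝ, volume] (fun t => (η ε)⁻¹ * ψ (t / η ε))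

/-- The net `(u_ε)` is a very weak solution of order `s`, with regularising family `(b_ε)`, of
`∂_t² u - Δ u + (b'/b) ∂_t u = 0` on `[0,∞) × ℝⁿ`, `u(0) = u₀`, `∂_t u(0) = u₁`. -/
structure IsVeryWeakSolution {n : ℕ} (b : ℝ → ℝ) (s : ℝ) (u₀ u₁ : TempDist n)
    (bε : ℝ → ℝ → ℝ) (u : ℝ → ℝ → TempDist n) : Prop where
  regularisation : IsModerateRegularisation b bε
  solves : ∀ ε ∈ Ioc (0 : ℝ) 1,
    IsSobolevSolution (Ici 0) (fun t => deriv (bε ε) t / bε ε t) s u₀ u₁ (u ε)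
  moderate : IsSobolevModerate s u

/-- `u ∈ C([0,T]; H^s) ∩ C¹([0,T]; H^{s-1})` is the classical (Sobolev) solution on `[0,T]` of
`∂_t² u - Δ u + (b'/b) ∂_t u = 0`, `u(0) = u₀`, `∂_t u(0) = u₁`. -/
def IsClassicalSolution {n : ℕ} (b : ℝ → ℝ) (s : ℝ) (u₀ u₁ : TempDist n) (T : ℝ)
    (u : ℝ → TempDist n) : Prop :=
  IsSobolevSolution (Icc 0 T) (fun t => derivWithin b (Ici 0) t / b t) s u₀ u₁ u

/-- `u_ε → v` in `C([0,T]; H^s) ∩ C¹([0,T]; H^{s-1})` as `ε → 0+`. -/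
def ConvergesInSobolev {n : ℕ} (s T : ℝ) (u : ℝ → ℝ → TempDist n) (v : ℝ → TempDist n) : Prop :=
  TendstoUniformlyOn (fun ε t => toSobolev s (u ε t)) (fun t => toSobolev s (v t))
    (𝓝[>] 0) (Icc 0 T) ∧
  TendstoUniformlyOn (fun ε t => toSobolev (s - 1) (u ε t)) (fun t => toSobolev (s - 1) (v t))
    (𝓝[>] 0) (Icc 0 T) ∧
  TendstoUniformlyOn (fun ε t => timeDeriv 1 (s - 1) (Icc 0 T) (u ε) t)
    (fun t => timeDeriv 1 (s - 1) (Icc 0 T) v t) (𝓝[>] 0) (Icc 0 T)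

end DissipativeWave

end

noncomputable section

/-! With `a = b'/b` and `J^r` the Bessel potential of order `r`, put `f = J^s u`, `g = J^(s-1) ∂_t
u` and `R = J^(-1)`, which is bounded on `L²`. In the Fourier normalisation used here `Δ = -(2π)²
(J² - 1)`, so the equation becomes the `L²` system `(R f)' = g`, `(R g)' = -(2π)² (f - R² f) - a R
g`, in which `s` no longer occurs. With `ν = 2π`, the combinations `g ± iν f` diagonalise the
principal part: each satisfies `(R y)' = ± iν y + R (ν² R f - a g)`. The principal part generates
the group of Fourier multipliers `exp(± iνt (1 + ‖ξ‖²)^(1/2))`, which are contractions, and the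
remainder is bounded on `L²`.

In the interaction picture `Φ = S(-t) U` the unbounded part disappears
(`hasDerivWithinAt_interaction`). What is left is a linear equation with bounded, strongly
continuous coefficients: Picard-Lindelöf solves it, and Gronwall's inequality makes its solution
depend continuously on `a` in the uniform norm (`IsLTwoSolution.stability`). Uniqueness is the case
of equal coefficients.

It remains to see that `b_ε'/b_ε` tends to `b'/b` uniformly on `[0,T]`
(`tendstoUniformlyOn_quotient`). This holds because `b_ε` and `b_ε'` are mollifications of the
continuous functions `B` and `B'`, and `B` is bounded away from zero. -/

namespace DissipativeWave

/-! ### Linear differential equations with bounded, strongly continuous coefficients -/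

section LinearODE

variable {Y W : Type*} [NormedAddCommGroup Y] [NormedSpace ℝ Y] [CompleteSpace Y]
  [NormedAddCommGroup W] [NormedSpace ℝ W]

/-- A function whose compositions with a separating family of continuous linear maps are
differentiable, with derivatives coming from a continuous function, is differentiable. -/
theorem hasDerivWithinAt_of_separating {ι : Type*} (ℓ : ι → Y →L[ℝ] W)
    (hℓ : ∀ y, (∀ i, ℓ i y = 0) → y = 0) {a b : ℝ} {v w : ℝ → Y} (hw : ContinuousOn w (Icc a b))
    (h : ∀ t ∈ Icc a b, ∀ i,
      HasDerivWithinAt (fun τ => ℓ i (v τ)) (ℓ i (w t)) (Icc a b) t) :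
    ∀ t ∈ Icc a b, HasDerivWithinAt v (w t) (Icc a b) t := by
  intro t ht
  have hab : a ≤ b := ht.1.trans ht.2
  set w' : ℝ → Y := IccExtend hab ((Icc a b).domRestrict w) with hw'
  have hw'c : Continuous w' := hw.domRestrict.Icc_extend'
  have hw'e : ∀ τ ∈ Icc a b, w' τ = w τ := fun τ hτ => by
    rw [hw', IccExtend_of_mem hab _ hτ]; rfl
  -- The primitive of `w` is the candidate for `v` up to a constant: each `ℓ i (v - P)` has zero
  -- derivative, and the `ℓ i` separate points.
  set P : ℝ → Y := fun τ => ∫ σ in a..τ, w' σ with hP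
  have hPd : ∀ τ, HasDerivAt P (w' τ) τ := fun τ =>
    intervalIntegral.integral_hasDerivAt_right (hw'c.intervalIntegrable _ _)
      (hw'c.stronglyMeasurableAtFilter _ _) hw'c.continuousAt
  have hconst : ∀ τ ∈ Icc a b, v τ - P τ = v a - P a := by
    intro τ hτ
    rw [← sub_eq_zero]
    refine hℓ _ fun i => ?_
    have hd : ∀ σ ∈ Icc a b, HasDerivWithinAt (fun σ => ℓ i (v σ) - ℓ i (P σ)) 0 (Icc a b) σ := by
      intro σ hσ
      have h1 := (h σ hσ i).sub
        ((ℓ i).hasFDerivAt.comp_hasDerivAt σ (hPd σ)).hasDerivWithinAt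
      rw [hw'e σ hσ, sub_self] at h1
      exact h1
    have := constant_of_derivWithin_zero (f := fun σ => ℓ i (v σ) - ℓ i (P σ)) (a := a) (b := b)
      (fun σ hσ => (hd σ hσ).differentiableWithinAt)
      (fun σ hσ => (hd σ ⟨hσ.1, hσ.2.le⟩).derivWithin
        (uniqueDiffOn_Icc (hσ.1.trans_lt hσ.2) σ ⟨hσ.1, hσ.2.le⟩)) τ hτ
    simp only [map_sub]
    exact sub_eq_zero.mpr this
  have h2 : HasDerivWithinAt (fun τ => P τ + (v a - P a)) (w t) (Icc a b) t := by
    rw [← hw'e t ht]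
    exact ((hPd t).add_const _).hasDerivWithinAt
  refine h2.congr (fun τ hτ => ?_) ?_
  · rw [← hconst τ hτ]; abel
  · rw [← hconst t ht]; abel

/-- On the ball of radius `‖y₀‖` about `y₀` the field is at most `2 M ‖y₀‖`, so a solution cannot
leave that ball within time `1 / (2 M)`. This length does not depend on `y₀`, which is what makes
continuation possible. -/
theorem exists_linear_ode_short {G : ℝ → Y →L[ℝ] Y} {M a b : ℝ} (hab : a ≤ b)
    (hG : ∀ y, ContinuousOn (fun t => G t y) (Icc a b)) (hM : ∀ t ∈ Icc a b, ‖G t‖ ≤ M)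
    (hs : (b - a) * M * 2 ≤ 1) (y₀ : Y) :
    ∃ Φ : ℝ → Y, Φ a = y₀ ∧ ∀ t ∈ Icc a b, HasDerivWithinAt Φ (G t (Φ t)) (Icc a b) t := by
  have hM0 : 0 ≤ M := (norm_nonneg _).trans (hM a ⟨le_rfl, hab⟩)
  have hpl : IsPicardLindelof (fun t y => G t y) (tmin := a) (tmax := b)
      ⟨a, le_rfl, hab⟩ y₀ ‖y₀‖₊ 0 (M.toNNReal * 2 * ‖y₀‖₊) M.toNNReal := by
    refine ⟨fun t ht => ?_, fun y _ => hG y, fun t ht y hy => ?_, ?_⟩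
    · refine ((G t).lipschitz.weaken ?_).lipschitzOnWith
      rw [← NNReal.coe_le_coe, Real.coe_toNNReal _ hM0]
      exact hM t ht
    · have h1 : ‖y‖ ≤ 2 * ‖y₀‖ := by
        have := mem_closedBall_iff_norm.mp hy
        have h2 := norm_le_norm_add_norm_sub' y y₀
        simp only [coe_nnnorm] at this
        linarith
      simp only [NNReal.coe_mul, Real.coe_toNNReal _ hM0, coe_nnnorm, NNReal.coe_ofNat]
      calc ‖G t y‖ ≤ ‖G t‖ * ‖y‖ := (G t).le_opNorm y
        _ ≤ M * (2 * ‖y₀‖) := by gcongr; exact hM t ht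
        _ = _ := by ring
    · simp only [NNReal.coe_mul, Real.coe_toNNReal _ hM0, coe_nnnorm, NNReal.coe_ofNat, sub_self,
        NNReal.coe_zero, sub_zero, max_eq_left (sub_nonneg.mpr hab)]
      nlinarith [norm_nonneg y₀]
  exact hpl.exists_eq_forall_mem_Icc_hasDerivWithinAt₀

theorem exists_linear_ode_aux {G : ℝ → Y →L[ℝ] Y} {M : ℝ} (N : ℕ) : ∀ {a b : ℝ}, a ≤ b →
    (∀ y, ContinuousOn (fun t => G t y) (Icc a b)) → (∀ t ∈ Icc a b, ‖G t‖ ≤ M) →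
    (b - a) * M * 2 ≤ N + 1 → ∀ y₀ : Y,
    ∃ Φ : ℝ → Y, Φ a = y₀ ∧ ∀ t ∈ Icc a b, HasDerivWithinAt Φ (G t (Φ t)) (Icc a b) t := by
  induction N with
  | zero =>
    intro a b hab hG hM hs y₀
    exact exists_linear_ode_short hab hG hM (by simpa using hs) y₀
  | succ N ih =>
    intro a b hab hG hM hs y₀
    -- The interval has room for `N + 2` equal short pieces; the last one is cut off and the
    -- induction hypothesis covers the rest.
    set c : ℝ := b - (b - a) / (N + 2) with hc
    have hN : (0 : ℝ) < N + 2 := by positivity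
    have hcb : c ≤ b := by
      have : 0 ≤ (b - a) / (N + 2) := div_nonneg (sub_nonneg.mpr hab) hN.le
      linarith
    have hac : a ≤ c := by
      have : (b - a) / (N + 2) ≤ b - a := div_le_self (sub_nonneg.mpr hab) (by linarith)
      linarith
    push_cast at hs
    have h1 : Icc a c ⊆ Icc a b := Icc_subset_Icc_right hcb
    have h2 : Icc c b ⊆ Icc a b := Icc_subset_Icc_left hac
    have hs' : (b - c) * M * 2 ≤ 1 := by
      have : (b - c) * M * 2 = ((b - a) * M * 2) / (N + 2) := by rw [hc]; field_simp; ring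
      rw [this, div_le_one hN]; linarith
    have hs'' : (c - a) * M * 2 ≤ N + 1 := by
      have : (c - a) * M * 2 = ((b - a) * M * 2) * ((N + 1) / (N + 2)) := by
        rw [hc]; field_simp; ring
      rw [this]
      calc _ ≤ ((N : ℝ) + 1 + 1) * ((N + 1) / (N + 2)) := by gcongr
        _ = N + 1 := by field_simp; ring
    obtain ⟨Φ, hΦ0, hΦ⟩ := ih hac (fun y => (hG y).mono h1) (fun t ht => hM t (h1 ht)) hs'' y₀
    obtain ⟨Ψ, hΨ0, hΨ⟩ := exists_linear_ode_short hcb (fun y => (hG y).mono h2)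
      (fun t ht => hM t (h2 ht)) hs' (Φ c)
    set Θ : ℝ → Y := fun t => if t ≤ c then Φ t else Ψ t with hΘ
    have e1 : ∀ t ∈ Icc a c, Θ t = Φ t := fun t ht => by simp [hΘ, ht.2]
    have e2 : ∀ t ∈ Icc c b, Θ t = Ψ t := fun t ht => by
      rcases ht.1.eq_or_lt with h | h
      · simp [hΘ, ← h, hΨ0]
      · simp [hΘ, not_le.mpr h]
    refine ⟨Θ, by rw [e1 a ⟨le_rfl, hac⟩, hΦ0], fun t ht => ?_⟩
    rw [← Icc_union_Icc_eq_Icc hac hcb]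
    refine HasDerivWithinAt.union ?_ ?_
    · by_cases h : t ∈ Icc a c
      · rw [e1 t h]
        exact (hΦ t h).congr e1 (e1 t h)
      -- Away from the closed piece the derivative within it is a vacuous condition.
      · exact HasFDerivWithinAt.of_notMem_closure (by rwa [isClosed_Icc.closure_eq])
    · by_cases h : t ∈ Icc c b
      · rw [e2 t h]
        exact (hΨ t h).congr e2 (e2 t h)
      · exact HasFDerivWithinAt.of_notMem_closure (by rwa [isClosed_Icc.closure_eq])

/-- A linear differential equation with bounded, strongly continuous coefficients has a global
solution. -/
theorem exists_linear_ode {G : ℝ → Y →L[ℝ] Y} {M a b : ℝ} (hab : a ≤ b)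
    (hG : ∀ y, ContinuousOn (fun t => G t y) (Icc a b)) (hM : ∀ t ∈ Icc a b, ‖G t‖ ≤ M) (y₀ : Y) :
    ∃ Φ : ℝ → Y, Φ a = y₀ ∧ ∀ t ∈ Icc a b, HasDerivWithinAt Φ (G t (Φ t)) (Icc a b) t := by
  obtain ⟨N, hN⟩ := exists_nat_ge ((b - a) * M * 2)
  exact exists_linear_ode_aux N hab hG hM (hN.trans (by linarith)) y₀

theorem hasDerivWithinAt_Ici_of_Icc {Z : Type*} [NormedAddCommGroup Z] [NormedSpace ℝ Z]
    {v : ℝ → Z} {v' : Z} {a b t : ℝ}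
    (h : HasDerivWithinAt v v' (Icc a b) t) (ht : t ∈ Ico a b) : HasDerivWithinAt v v' (Ici t) t :=
  h.mono_of_mem_nhdsWithin (mem_of_superset (Icc_mem_nhdsGE ht.2)
    (Icc_subset_Icc_left ht.1))

/-- Stability of linear differential equations under perturbations of the coefficients. -/
theorem norm_sub_le_of_linear_ode {Z : Type*} [NormedAddCommGroup Z] [NormedSpace ℝ Z]
    {G H : ℝ → Z →L[ℝ] Z} {M δ D T : ℝ} {Φ Ψ : ℝ → Z} (hM0 : 0 ≤ M)
    (hM : ∀ t ∈ Icc 0 T, ‖G t‖ ≤ M)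
    (hΦ : ∀ t ∈ Icc 0 T, HasDerivWithinAt Φ (G t (Φ t)) (Icc 0 T) t)
    (hΨ : ∀ t ∈ Icc 0 T, HasDerivWithinAt Ψ (H t (Ψ t)) (Icc 0 T) t)
    (hD : ∀ t ∈ Icc 0 T, ‖Ψ t‖ ≤ D) (hδ : ∀ t ∈ Icc 0 T, ‖G t - H t‖ ≤ δ) (h0 : Φ 0 = Ψ 0) :
    ∀ t ∈ Icc 0 T, ‖Φ t - Ψ t‖ ≤ gronwallBound 0 M (δ * D) T := by
  intro t ht
  have hδ0 : 0 ≤ δ := (norm_nonneg _).trans (hδ t ht)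
  have hD0 : 0 ≤ D := (norm_nonneg _).trans (hD t ht)
  have hsub : Ico 0 T ⊆ Icc 0 T := Ico_subset_Icc_self
  -- `Φ` is an exact trajectory of `G`, and `Ψ` an approximate one with error `‖(G - H) Ψ‖ ≤ δ D`.
  have := dist_le_of_approx_trajectories_ODE_of_mem (v := fun t y => G t y) (s := fun _ => univ)
    (K := M.toNNReal) (a := 0) (b := T) (f := Φ) (g := Ψ) (f' := fun t => G t (Φ t))
    (g' := fun t => H t (Ψ t)) (εf := 0) (εg := δ * D) (δ := 0)
    (fun τ hτ => ((G τ).lipschitz.weaken (by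
      rw [← NNReal.coe_le_coe, Real.coe_toNNReal _ hM0]; exact hM τ (hsub hτ))).lipschitzOnWith)
    (fun τ hτ => (hΦ τ hτ).continuousWithinAt)
    (fun τ hτ => hasDerivWithinAt_Ici_of_Icc (hΦ τ (hsub hτ)) hτ) (fun τ hτ => by simp)
    (fun _ _ => trivial)
    (fun τ hτ => (hΨ τ hτ).continuousWithinAt)
    (fun τ hτ => hasDerivWithinAt_Ici_of_Icc (hΨ τ (hsub hτ)) hτ) (fun τ hτ => by
      rw [dist_eq_norm, norm_sub_rev, ← sub_apply]
      refine ((G τ - H τ).le_opNorm _).trans ?_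
      gcongr
      · exact hδ τ (hsub hτ)
      · exact hD τ (hsub hτ)) (fun _ _ => trivial) (by simp [h0]) t ht
  rw [dist_eq_norm, sub_zero, Real.coe_toNNReal _ hM0, zero_add] at this
  exact this.trans (gronwallBound_mono le_rfl (by positivity) hM0 ht.2)

end LinearODE

/-! ### Groups with unbounded generator and the interaction picture -/

section SmoothedGroup

variable {Y : Type*} [NormedAddCommGroup Y] [NormedSpace ℝ Y]

/-- A contraction group `S` generated by `A R⁻¹`, where the injective operator `R` with dense range
commutes with `A` and `S`; the relation with the generator is expressed through the bounded
operators `R² S(t)` and `R A S(t)`. -/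
structure IsSmoothedGroup (R A : Y →L[ℝ] Y) (S : ℝ → Y →L[ℝ] Y) : Prop where
  inj : Function.Injective R
  dense : DenseRange R
  comm_R : ∀ t y, R (S t y) = S t (R y)
  comm_A : ∀ t y, A (S t y) = S t (A y)
  comm_RA : ∀ y, R (A y) = A (R y)
  zero : ∀ y, S 0 y = y
  neg_apply : ∀ t y, S (-t) (S t y) = y
  norm_le : ∀ t y, ‖S t y‖ ≤ ‖y‖
  hasDerivAt : ∀ t, HasDerivAt (fun t => (R ∘L R) ∘L S t) ((R ∘L A) ∘L S t) t

namespace IsSmoothedGroup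

variable {R A : Y →L[ℝ] Y} {S : ℝ → Y →L[ℝ] Y}

theorem apply_neg (hS : IsSmoothedGroup R A S) (t : ℝ) (y : Y) : S t (S (-t) y) = y := by
  simpa using hS.neg_apply (-t) y

/-- On the dense range of `R²` orbits are continuous, since `R² S(t)` is differentiable in operator
norm; the uniform Lipschitz bound carries this over to all of `Y`, jointly in time and vector. -/
theorem continuous_uncurry (hS : IsSmoothedGroup R A S) :
    Continuous (fun p : ℝ × Y => S p.1 p.2) := by
  have hd : DenseRange (R ∘L R) := hS.dense.comp hS.dense R.continuous
  refine continuous_prod_of_dense_continuous_lipschitzWith' _ 1 hd (fun t => ?_) ?_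
  · refine LipschitzWith.of_dist_le_mul fun x y => ?_
    simpa [dist_eq_norm, ← map_sub] using hS.norm_le t (x - y)
  · rintro _ ⟨y, rfl⟩
    have h1 : Continuous (fun t => (R ∘L R) ∘L S t) :=
      continuous_iff_continuousAt.mpr fun t => (hS.hasDerivAt t).continuousAt
    have h2 : (fun t => S t ((R ∘L R) y)) = fun t => ((R ∘L R) ∘L S t) y := by
      ext t; simp [hS.comm_R]
    simp only
    rw [h2]
    exact h1.clm_apply continuous_const

theorem continuousOn_apply (hS : IsSmoothedGroup R A S) {τ : ℝ → ℝ} {u : ℝ → Y} {I : Set ℝ}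
    (hτ : ContinuousOn τ I) (hu : ContinuousOn u I) : ContinuousOn (fun t => S (τ t) (u t)) I :=
  hS.continuous_uncurry.comp_continuousOn (hτ.prodMk hu)

theorem norm_comp_comp_le (hS : IsSmoothedGroup R A S) (t : ℝ) (B : Y →L[ℝ] Y) :
    ‖S (-t) ∘L B ∘L S t‖ ≤ ‖B‖ := by
  refine ContinuousLinearMap.opNorm_le_bound _ (norm_nonneg _) fun y => ?_
  calc ‖S (-t) (B (S t y))‖ ≤ ‖B (S t y)‖ := hS.norm_le _ _
    _ ≤ ‖B‖ * ‖S t y‖ := B.le_opNorm _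
    _ ≤ ‖B‖ * ‖y‖ := by gcongr; exact hS.norm_le _ _

variable [CompleteSpace Y]

/-- In the interaction picture the equation `(R U)' = A U + R F(t) U` becomes
`Φ' = S(-t) F(t) S(t) Φ`. -/
theorem hasDerivWithinAt_interaction (hS : IsSmoothedGroup R A S) {F : ℝ → Y →L[ℝ] Y} {T : ℝ}
    (hF : ContinuousOn F (Icc 0 T)) {U : ℝ → Y} (hU : ContinuousOn U (Icc 0 T))
    (hd : ∀ t ∈ Icc 0 T,
      HasDerivWithinAt (fun τ => R (U τ)) (A (U t) + R (F t (U t))) (Icc 0 T) t) :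
    ∀ t ∈ Icc 0 T, HasDerivWithinAt (fun τ => S (-τ) (U τ))
      ((S (-t) ∘L F t ∘L S t) (S (-t) (U t))) (Icc 0 T) t := by
  have hFU : ContinuousOn (fun t => S (-t) (F t (U t))) (Icc 0 T) :=
    hS.continuousOn_apply continuousOn_neg (hF.clm_apply hU)
  intro t ht
  -- Three factors of `R` are needed: two make `S` differentiable in norm, and one makes `U`
  -- differentiable. Their composite is injective, hence separating on its own, and the two
  -- contributions of `A` cancel.
  have key := hasDerivWithinAt_of_separating (fun _ : Unit => R ∘L R ∘L R)
    (fun y hy => by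
      have := hy ()
      simp only [ContinuousLinearMap.comp_apply] at this
      have h0 : ∀ y, R y = 0 → y = 0 := fun y h => hS.inj (by rw [h, map_zero])
      exact h0 _ (h0 _ (h0 _ this))) (v := fun τ => S (-τ) (U τ)) hFU
    (fun t ht _ => by
      have h1 : HasDerivAt (fun τ : ℝ => (R ∘L R) ∘L S (-τ)) (-((R ∘L A) ∘L S (-t))) t := by
        have h0 := (hS.hasDerivAt (-t)).scomp t (hasDerivAt_neg t)
        rw [neg_one_smul] at h0
        exact h0
      have h2 := h1.hasDerivWithinAt.clm_apply (hd t ht)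
      refine (h2.congr_deriv ?_).congr (fun τ _ => ?_) ?_
      · simp only [_root_.neg_apply, ContinuousLinearMap.comp_apply, map_add]
        simp only [hS.comm_R, hS.comm_A, hS.comm_RA]
        abel
      · simp [hS.comm_R]
      · simp [hS.comm_R]) t ht
  refine key.congr_deriv ?_
  simp [hS.apply_neg]

/-- The equation is solved in the interaction picture and carried back as `U = S(t) Φ`. The product
rule is available for `R² S(t) Φ(t)`, that is, after one more application of the injective `R` to `R
U`. -/
theorem exists_solution (hS : IsSmoothedGroup R A S) {F : ℝ → Y →L[ℝ] Y} {T : ℝ} (hT : 0 ≤ T)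
    (hF : ContinuousOn F (Icc 0 T)) (y₀ : Y) :
    ∃ U : ℝ → Y, U 0 = y₀ ∧ ContinuousOn U (Icc 0 T) ∧ ∀ t ∈ Icc 0 T,
      HasDerivWithinAt (fun τ => R (U τ)) (A (U t) + R (F t (U t))) (Icc 0 T) t := by
  obtain ⟨M, hM⟩ := isCompact_Icc.exists_bound_of_continuousOn hF
  obtain ⟨Φ, hΦ0, hΦ⟩ := exists_linear_ode (G := fun t => S (-t) ∘L F t ∘L S t) hT
    (fun y => hS.continuousOn_apply continuousOn_neg
      (hF.clm_apply (hS.continuousOn_apply continuousOn_id continuousOn_const)))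
    (fun t ht => (hS.norm_comp_comp_le t (F t)).trans (hM t ht)) y₀
  have hΦc : ContinuousOn Φ (Icc 0 T) := fun t ht => (hΦ t ht).continuousWithinAt
  have hU : ContinuousOn (fun t => S t (Φ t)) (Icc 0 T) :=
    hS.continuousOn_apply continuousOn_id hΦc
  refine ⟨fun t => S t (Φ t), by simp [hS.zero, hΦ0], hU, ?_⟩
  refine hasDerivWithinAt_of_separating (fun _ : Unit => R)
    (fun y hy => hS.inj (by rw [hy (), map_zero])) ?_ (fun t ht _ => ?_)
  · exact (A.continuous.comp_continuousOn hU).add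
      (R.continuous.comp_continuousOn (hF.clm_apply hU))
  · have h2 := (hS.hasDerivAt t).hasDerivWithinAt.clm_apply (hΦ t ht)
    refine (h2.congr_deriv ?_)
    simp only [ContinuousLinearMap.comp_apply, map_add]
    simp only [hS.apply_neg]

/-- Conjugation by the contractions `S(t)` and `S(-t)` increases none of the norms involved, so the
bound for bounded coefficients transfers with the same constants. -/
theorem norm_sub_le (hS : IsSmoothedGroup R A S) {F F' : ℝ → Y →L[ℝ] Y} {M δ D T : ℝ}
    {U V : ℝ → Y} (hM0 : 0 ≤ M) (hM : ∀ t ∈ Icc 0 T, ‖F t‖ ≤ M)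
    (hF : ContinuousOn F (Icc 0 T)) (hF' : ContinuousOn F' (Icc 0 T))
    (hU : ContinuousOn U (Icc 0 T)) (hV : ContinuousOn V (Icc 0 T))
    (hdU : ∀ t ∈ Icc 0 T,
      HasDerivWithinAt (fun τ => R (U τ)) (A (U t) + R (F t (U t))) (Icc 0 T) t)
    (hdV : ∀ t ∈ Icc 0 T,
      HasDerivWithinAt (fun τ => R (V τ)) (A (V t) + R (F' t (V t))) (Icc 0 T) t)
    (hD : ∀ t ∈ Icc 0 T, ‖V t‖ ≤ D) (hδ : ∀ t ∈ Icc 0 T, ‖F t - F' t‖ ≤ δ) (h0 : U 0 = V 0) :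
    ∀ t ∈ Icc 0 T, ‖U t - V t‖ ≤ gronwallBound 0 M (δ * D) T := by
  intro t ht
  have := norm_sub_le_of_linear_ode hM0
    (fun t ht => (hS.norm_comp_comp_le t (F t)).trans (hM t ht))
    (hS.hasDerivWithinAt_interaction hF hU hdU) (hS.hasDerivWithinAt_interaction hF' hV hdV)
    (fun t ht => (hS.norm_le _ _).trans (hD t ht)) (δ := δ) (fun t ht => by
      have := hS.norm_comp_comp_le t (F t - F' t)
      rw [ContinuousLinearMap.sub_comp, ContinuousLinearMap.comp_sub] at this
      exact this.trans (hδ t ht)) (by simp [h0]) t ht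
  rw [← map_sub] at this
  calc ‖U t - V t‖ = ‖S t (S (-t) (U t - V t))‖ := by rw [hS.apply_neg]
    _ ≤ _ := (hS.norm_le _ _).trans this

end IsSmoothedGroup

end SmoothedGroup

/-! ### Fourier multipliers on `L²` and the half-wave group -/

section FourierMultipliers

open FourierTransform
open scoped BoundedContinuousFunction

/-- `L²(ℝⁿ)`. -/
abbrev LTwo (n : ℕ) : Type := Lp ℂ 2 (volume : Measure (EuclideanSpace ℝ (Fin n)))

section Multiplier

variable {n : ℕ}

/-- A bounded continuous function as an element of `L^∞`. -/
def bcfToLp (g : EuclideanSpace ℝ (Fin n) →ᵇ ℂ) :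
    Lp ℂ ⊤ (volume : Measure (EuclideanSpace ℝ (Fin n))) :=
  (g.memLp_top (μ := volume)).toLp _

theorem coeFn_bcfToLp_smul (g : EuclideanSpace ℝ (Fin n) →ᵇ ℂ) (x : LTwo n) :
    (bcfToLp g • x : LTwo n) =ᵐ[volume] fun ξ => g ξ * x ξ := by
  filter_upwards [Lp.coeFn_lpSMul (r := 2) (bcfToLp g) x,
    (g.memLp_top (μ := volume)).coeFn_toLp] with ξ h1 h2
  rw [h1]
  simp only [Pi.smul_apply', smul_eq_mul, bcfToLp, h2]

theorem norm_bcfToLp_smul_le (g : EuclideanSpace ℝ (Fin n) →ᵇ ℂ) (x : LTwo n) :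
    ‖(bcfToLp g • x : LTwo n)‖ ≤ ‖g‖ * ‖x‖ := by
  refine Lp.norm_le_mul_norm_of_ae_le_mul ?_
  filter_upwards [coeFn_bcfToLp_smul g x] with ξ h
  rw [h, norm_mul]
  gcongr
  exact g.norm_coe_le_norm ξ

theorem fourierInv_real_smul (c : ℝ) (x : LTwo n) : 𝓕⁻ (c • x) = c • 𝓕⁻ x :=
  (Lp.fourierTransformₗᵢ (EuclideanSpace ℝ (Fin n)) ℂ).symm.toLinearEquiv.toLinearMap.map_smul_of_tower
    c x

theorem fourier_real_smul (c : ℝ) (x : LTwo n) : 𝓕 (c • x) = c • 𝓕 x :=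
  (Lp.fourierTransformₗᵢ (EuclideanSpace ℝ (Fin n)) ℂ).toLinearEquiv.toLinearMap.map_smul_of_tower c x

/-- The Fourier multiplier operators on `L²` with bounded continuous symbols. -/
def multL (n : ℕ) : (EuclideanSpace ℝ (Fin n) →ᵇ ℂ) →L[ℝ] LTwo n →L[ℝ] LTwo n :=
  LinearMap.mkContinuous₂ (LinearMap.mk₂ ℝ
    (fun g x => 𝓕⁻ (bcfToLp g • 𝓕 x : LTwo n))
    (fun g g' x => by
      rw [← FourierTransform.fourierInv_add]
      congr 1
      ext1
      filter_upwards [coeFn_bcfToLp_smul (g + g') (𝓕 x), coeFn_bcfToLp_smul g (𝓕 x),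
        coeFn_bcfToLp_smul g' (𝓕 x), Lp.coeFn_add (bcfToLp g • 𝓕 x : LTwo n)
          (bcfToLp g' • 𝓕 x : LTwo n)] with ξ h1 h2 h3 h4
      rw [h1, h4, Pi.add_apply, h2, h3, BoundedContinuousFunction.add_apply, add_mul])
    (fun c g x => by
      have : ∀ y : LTwo n, 𝓕⁻ (c • y) = c • 𝓕⁻ y := fun y => fourierInv_real_smul c y
      rw [← this]
      congr 1
      ext1
      filter_upwards [coeFn_bcfToLp_smul (c • g) (𝓕 x), coeFn_bcfToLp_smul g (𝓕 x),
        Lp.coeFn_smul c (bcfToLp g • 𝓕 x : LTwo n)] with ξ h1 h2 h3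
      rw [h1, h3, Pi.smul_apply, h2, BoundedContinuousFunction.smul_apply, smul_mul_assoc])
    (fun g x y => by
      rw [FourierTransform.fourier_add, Lp.add_smul, FourierTransform.fourierInv_add])
    (fun c g x => by
      have h : ∀ y : LTwo n, 𝓕⁻ (c • y) = c • 𝓕⁻ y := fun y => fourierInv_real_smul c y
      have h' : ∀ y : LTwo n, 𝓕 (c • y) = c • 𝓕 y := fun y => fourier_real_smul c y
      rw [← h, h']
      congr 1
      ext1
      filter_upwards [coeFn_bcfToLp_smul g (c • 𝓕 x), coeFn_bcfToLp_smul g (𝓕 x),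
        Lp.coeFn_smul c (𝓕 x),
        Lp.coeFn_smul c (bcfToLp g • 𝓕 x : LTwo n)] with ξ h1 h2 h3 h4
      rw [h1, h4, Pi.smul_apply, h2, h3, Pi.smul_apply, mul_smul_comm])) 1
    (fun g x => by
      simp only [LinearMap.mk₂_apply, one_mul]
      have h : ‖(𝓕⁻ (bcfToLp g • 𝓕 x : LTwo n) : LTwo n)‖ = ‖(bcfToLp g • 𝓕 x : LTwo n)‖ :=
        (Lp.fourierTransformₗᵢ _ _).symm.norm_map _
      rw [h]
      refine (norm_bcfToLp_smul_le g (𝓕 x)).trans ?_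
      rw [Lp.norm_fourier_eq])

theorem multL_apply (g : EuclideanSpace ℝ (Fin n) →ᵇ ℂ) (x : LTwo n) :
    multL n g x = 𝓕⁻ (bcfToLp g • 𝓕 x : LTwo n) := rfl

theorem norm_multL_apply_le (g : EuclideanSpace ℝ (Fin n) →ᵇ ℂ) (x : LTwo n) :
    ‖multL n g x‖ ≤ ‖g‖ * ‖x‖ := by
  have h : ‖(𝓕⁻ (bcfToLp g • 𝓕 x : LTwo n) : LTwo n)‖ = ‖(bcfToLp g • 𝓕 x : LTwo n)‖ :=
    (Lp.fourierTransformₗᵢ _ _).symm.norm_map _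
  rw [multL_apply, h]
  refine (norm_bcfToLp_smul_le g (𝓕 x)).trans ?_
  rw [Lp.norm_fourier_eq]

theorem multL_mul_apply (g g' : EuclideanSpace ℝ (Fin n) →ᵇ ℂ) (x : LTwo n) :
    multL n (g * g') x = multL n g (multL n g' x) := by
  simp only [multL_apply, FourierTransform.fourier_fourierInv_eq]
  congr 1
  ext1
  filter_upwards [coeFn_bcfToLp_smul (g * g') (𝓕 x), coeFn_bcfToLp_smul g' (𝓕 x),
    coeFn_bcfToLp_smul g (bcfToLp g' • 𝓕 x : LTwo n)] with ξ h1 h2 h3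
  rw [h1, h3, h2, BoundedContinuousFunction.mul_apply, mul_assoc]

theorem multL_comm_apply (g g' : EuclideanSpace ℝ (Fin n) →ᵇ ℂ) (x : LTwo n) :
    multL n g (multL n g' x) = multL n g' (multL n g x) := by
  rw [← multL_mul_apply, mul_comm, multL_mul_apply]

theorem multL_const_apply (c : ℂ) (x : LTwo n) :
    multL n (BoundedContinuousFunction.const _ c) x = c • x := by
  have : (bcfToLp (BoundedContinuousFunction.const (EuclideanSpace ℝ (Fin n)) c) • 𝓕 x : LTwo n) =
      c • 𝓕 x := by
    ext1
    filter_upwards [coeFn_bcfToLp_smul (BoundedContinuousFunction.const _ c) (𝓕 x),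
      Lp.coeFn_smul c (𝓕 x)] with ξ h1 h2
    rw [h1, h2, BoundedContinuousFunction.const_apply, Pi.smul_apply, smul_eq_mul]
  rw [multL_apply, this, FourierTransform.fourierInv_smul, FourierTransform.fourierInv_fourier_eq]

theorem multL_one_apply (x : LTwo n) : multL n 1 x = x := by
  have h := multL_const_apply 1 x
  rwa [one_smul] at h

/-- The bridge from `L²` operators to multipliers on distributions. It is used for the Bessel symbol
only; the wave symbols act on `L²` alone. -/
theorem toTempDist_multL {g : EuclideanSpace ℝ (Fin n) →ᵇ ℂ}
    (hg : Function.HasTemperateGrowth g) (x : LTwo n) :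
    ((multL n g x : LTwo n) : TempDist n) = fourierMultiplierCLM ℂ g (x : TempDist n) := by
  rw [fourierMultiplierCLM_apply, multL_apply, ← Lp.fourierInv_toTemperedDistribution_eq,
    bcfToLp, Lp.toTemperedDistribution_smul_eq hg, Lp.fourier_toTemperedDistribution_eq]

end Multiplier

section Symbols

variable {n : ℕ}

/-- The symbol `(1 + ‖ξ‖²)^{-1/2}` of the Bessel potential of order `-1`. -/
def invJapaneseBracket (n : ℕ) : EuclideanSpace ℝ (Fin n) →ᵇ ℂ :=
  BoundedContinuousFunction.ofNormedAddCommGroup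
    (fun ξ => (((1 + ‖ξ‖ ^ 2) ^ ((-1 : ℝ) / 2) : ℝ) : ℂ))
    (Complex.continuous_ofReal.comp (Continuous.rpow_const (by fun_prop)
      fun ξ => Or.inl (by positivity))) 1 fun ξ => by
    rw [Complex.norm_real, Real.norm_eq_abs, abs_eq_self.mpr (by positivity)]
    exact Real.rpow_le_one_of_one_le_of_nonpos (by simp) (by norm_num)

/-- The symbol `exp(i ν t (1 + ‖ξ‖²)^{1/2})`. -/
def waveSymbol (n : ℕ) (ν t : ℝ) : EuclideanSpace ℝ (Fin n) →ᵇ ℂ :=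
  BoundedContinuousFunction.ofNormedAddCommGroup
    (fun ξ => Complex.exp (Complex.I * ((ν * t * (1 + ‖ξ‖ ^ 2) ^ ((1 : ℝ) / 2) : ℝ) : ℂ)))
    (Complex.continuous_exp.comp (continuous_const.mul (Complex.continuous_ofReal.comp
      (continuous_const.mul (Continuous.rpow_const (by fun_prop)
      fun ξ => Or.inl (by positivity)))))) 1 fun ξ => by
    rw [Complex.norm_exp_I_mul_ofReal]

theorem invJapaneseBracket_apply (ξ : EuclideanSpace ℝ (Fin n)) :
    invJapaneseBracket n ξ = (((1 + ‖ξ‖ ^ 2) ^ ((-1 : ℝ) / 2) : ℝ) : ℂ) := rfl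

theorem waveSymbol_apply (ν t : ℝ) (ξ : EuclideanSpace ℝ (Fin n)) : waveSymbol n ν t ξ =
    Complex.exp (Complex.I * ((ν * t * (1 + ‖ξ‖ ^ 2) ^ ((1 : ℝ) / 2) : ℝ) : ℂ)) := rfl

theorem norm_waveSymbol_le (ν t : ℝ) : ‖waveSymbol n ν t‖ ≤ 1 :=
  BoundedContinuousFunction.norm_ofNormedAddCommGroup_le _ zero_le_one _

theorem waveSymbol_zero (ν : ℝ) : waveSymbol n ν 0 = 1 := by
  ext ξ; simp [waveSymbol_apply]

theorem waveSymbol_neg_mul (ν t : ℝ) : waveSymbol n ν (-t) * waveSymbol n ν t = 1 := by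
  ext ξ
  rw [BoundedContinuousFunction.mul_apply, waveSymbol_apply, waveSymbol_apply, ← Complex.exp_add,
    ← mul_add, ← Complex.ofReal_add]
  simp

/-- A quadratic bound valid for every real `x`: Taylor's estimate for `|x| ≤ 1`, and the crude bound
`2|x| ≤ 2x²` beyond. Uniformity matters because `x` will be a multiple of the unbounded `(1 +
‖ξ‖²)^(1/2)`. -/
theorem norm_exp_I_mul_sub_one_sub_le (x : ℝ) :
    ‖Complex.exp (Complex.I * x) - 1 - Complex.I * x‖ ≤ 2 * x ^ 2 := by
  rcases le_total |x| 1 with h | h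
  · have h1 := Complex.norm_exp_sub_one_sub_id_le (x := Complex.I * x) (by simpa using h)
    refine h1.trans ?_
    simp only [norm_mul, Complex.norm_I, one_mul, Complex.norm_real, Real.norm_eq_abs, sq_abs]
    nlinarith [sq_nonneg x]
  · refine (norm_sub_le _ _).trans ?_
    have h1 : ‖Complex.exp (Complex.I * x) - 1‖ ≤ |x| := by
      simpa using Real.norm_exp_I_mul_ofReal_sub_one_le (x := x)
    have h2 : ‖Complex.I * (x : ℂ)‖ = |x| := by simp
    rw [h2, ← sq_abs x]
    nlinarith

/-- The second-order Taylor remainder in time grows like `1 + ‖ξ‖²`, and exactly two factors `(1 +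
‖ξ‖²)^(-1/2)` absorb it. This is why differentiability of the group is stated for `R² S(t)`. -/
theorem norm_waveSymbol_remainder_le (ν t h : ℝ) :
    ‖invJapaneseBracket n * invJapaneseBracket n * waveSymbol n ν (t + h)
      - invJapaneseBracket n * invJapaneseBracket n * waveSymbol n ν t
      - h • (invJapaneseBracket n * BoundedContinuousFunction.const _ (Complex.I * ν)
        * waveSymbol n ν t)‖ ≤ 2 * ν ^ 2 * h ^ 2 := by
  refine (BoundedContinuousFunction.norm_le (by positivity)).mpr fun ξ => ?_
  simp only [BoundedContinuousFunction.sub_apply, BoundedContinuousFunction.mul_apply,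
    BoundedContinuousFunction.smul_apply, BoundedContinuousFunction.const_apply,
    waveSymbol_apply, invJapaneseBracket_apply]
  have hpos : (0 : ℝ) < 1 + ‖ξ‖ ^ 2 := by positivity
  set ρ : ℝ := (1 + ‖ξ‖ ^ 2) ^ ((-1 : ℝ) / 2) with hρ
  set κ : ℝ := (1 + ‖ξ‖ ^ 2) ^ ((1 : ℝ) / 2) with hκ
  have hρκ : ρ * κ = 1 := by
    rw [hρ, hκ, ← Real.rpow_add hpos]; norm_num
  have hρκ' : (ρ : ℂ) * κ = 1 := by exact_mod_cast hρκ
  have e1 : Complex.exp (Complex.I * ((ν * (t + h) * κ : ℝ) : ℂ)) =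
      Complex.exp (Complex.I * ((ν * t * κ : ℝ) : ℂ)) *
        Complex.exp (Complex.I * ((ν * h * κ : ℝ) : ℂ)) := by
    rw [← Complex.exp_add]; congr 1; push_cast; ring
  have e2 : (ρ : ℂ) * ρ * Complex.exp (Complex.I * ((ν * (t + h) * κ : ℝ) : ℂ))
      - ρ * ρ * Complex.exp (Complex.I * ((ν * t * κ : ℝ) : ℂ))
      - h • (ρ * (Complex.I * ν) * Complex.exp (Complex.I * ((ν * t * κ : ℝ) : ℂ)))
      = ρ * ρ * Complex.exp (Complex.I * ((ν * t * κ : ℝ) : ℂ)) *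
        (Complex.exp (Complex.I * ((ν * h * κ : ℝ) : ℂ)) - 1
          - Complex.I * ((ν * h * κ : ℝ) : ℂ)) := by
    rw [e1, Complex.real_smul]
    push_cast
    linear_combination (ρ * h * Complex.I * ν *
      Complex.exp (Complex.I * ((ν : ℂ) * t * κ))) * hρκ'
  rw [e2, norm_mul, norm_mul, Complex.norm_exp_I_mul_ofReal, norm_mul, Complex.norm_real, mul_one]
  calc ‖ρ‖ * ‖ρ‖ * _ ≤ ‖ρ‖ * ‖ρ‖ * (2 * (ν * h * κ) ^ 2) := by
        gcongr; exact norm_exp_I_mul_sub_one_sub_le _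
    _ = 2 * ν ^ 2 * h ^ 2 * (ρ * κ) ^ 2 := by
        rw [Real.norm_eq_abs, abs_mul_abs_self]; ring
    _ = 2 * ν ^ 2 * h ^ 2 := by rw [hρκ]; ring

theorem hasDerivAt_of_norm_remainder_le {Z : Type*} [NormedAddCommGroup Z] [NormedSpace ℝ Z]
    {f : ℝ → Z} {f' : Z} {t C : ℝ} (hf : ∀ h, ‖f (t + h) - f t - h • f'‖ ≤ C * h ^ 2) :
    HasDerivAt f f' t := by
  rw [hasDerivAt_iff_isLittleO_nhds_zero]
  refine (Asymptotics.IsBigO.of_bound C (g := fun h : ℝ => h ^ 2)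
    (Eventually.of_forall fun h => ?_)).trans_isLittleO (Asymptotics.isLittleO_pow_id one_lt_two)
  simpa using hf h

theorem hasDerivAt_waveSymbol (ν t : ℝ) :
    HasDerivAt (fun t => invJapaneseBracket n * invJapaneseBracket n * waveSymbol n ν t)
      (invJapaneseBracket n * BoundedContinuousFunction.const _ (Complex.I * ν)
        * waveSymbol n ν t) t :=
  hasDerivAt_of_norm_remainder_le (norm_waveSymbol_remainder_le ν t)

/-- The Bessel potential of order `-1` on `L²`. -/
def besselInv (n : ℕ) : LTwo n →L[ℝ] LTwo n := multL n (invJapaneseBracket n)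

theorem toTempDist_besselInv (x : LTwo n) :
    ((besselInv n x : LTwo n) : TempDist n) =
      besselPotential (EuclideanSpace ℝ (Fin n)) ℂ (-1) (x : TempDist n) := by
  have h : (invJapaneseBracket n : EuclideanSpace ℝ (Fin n) → ℂ) =
      fun ξ => (((1 + ‖ξ‖ ^ 2) ^ ((-1 : ℝ) / 2) : ℝ) : ℂ) := rfl
  rw [besselInv, toTempDist_multL (by rw [h]; fun_prop), besselPotential, h]

theorem besselInv_injective : Function.Injective (besselInv n) := by
  intro x y hxy
  apply SobolevSpace.coe_Lp_injective
  have h : ((besselInv n x : LTwo n) : TempDist n) = (besselInv n y : LTwo n) := by rw [hxy]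
  rw [toTempDist_besselInv, toTempDist_besselInv] at h
  simpa using congrArg (besselPotential (EuclideanSpace ℝ (Fin n)) ℂ 1) h

/-- Every Schwartz function `φ` is `J^(-1) (J φ)` with `J φ` again Schwartz, and Schwartz functions
are dense in `L²`. -/
theorem besselInv_denseRange : DenseRange (besselInv n) := by
  have hd := SchwartzMap.denseRange_toLpCLM (E := EuclideanSpace ℝ (Fin n)) (F := ℂ)
    (μ := volume) (p := 2) ENNReal.ofNat_ne_top
  refine hd.mono ?_
  rintro _ ⟨φ, rfl⟩
  set g : EuclideanSpace ℝ (Fin n) → ℂ := fun x => (((1 + ‖x‖ ^ 2) ^ ((1 : ℝ) / 2) : ℝ) : ℂ)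
  refine ⟨(SchwartzMap.fourierMultiplierCLM ℂ g φ).toLp 2, ?_⟩
  apply SobolevSpace.coe_Lp_injective
  have hg : Function.HasTemperateGrowth g := by fun_prop
  have h1 : besselPotential (EuclideanSpace ℝ (Fin n)) ℂ 1 (φ : TempDist n) =
      (SchwartzMap.fourierMultiplierCLM ℂ g φ : TempDist n) := by
    rw [← fourierMultiplierCLM_toTemperedDistributionCLM_eq hg]; rfl
  rw [toTempDist_besselInv, Lp.toTemperedDistribution_toLp_eq, ← h1,
    besselPotential_besselPotential_apply]
  simp [Lp.toTemperedDistribution_toLp_eq]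

theorem isSmoothedGroup_wave (ν : ℝ) : IsSmoothedGroup (besselInv n)
    (multL n (BoundedContinuousFunction.const _ (Complex.I * ν)))
    (fun t => multL n (waveSymbol n ν t)) where
  inj := besselInv_injective
  dense := besselInv_denseRange
  comm_R _ _ := multL_comm_apply _ _ _
  comm_A _ _ := multL_comm_apply _ _ _
  comm_RA _ := multL_comm_apply _ _ _
  zero y := by rw [waveSymbol_zero, multL_one_apply]
  neg_apply t y := by rw [← multL_mul_apply, waveSymbol_neg_mul, multL_one_apply]
  norm_le t y := (norm_multL_apply_le _ _).trans
    (mul_le_of_le_one_left (norm_nonneg _) (norm_waveSymbol_le ν t))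
  hasDerivAt t := by
    have h := (multL n).hasFDerivAt.comp_hasDerivAt t (hasDerivAt_waveSymbol (n := n) ν t)
    refine (h.congr_deriv ?_).congr_of_eventuallyEq (Eventually.of_forall fun τ => ?_)
    · ext1 x
      simp [multL_mul_apply, besselInv]
    · ext1 x
      simp [multL_mul_apply, besselInv]

end Symbols

theorem IsSmoothedGroup.prodMap {Y Z : Type*} [NormedAddCommGroup Y] [NormedSpace ℝ Y]
    [NormedAddCommGroup Z] [NormedSpace ℝ Z] {R A : Y →L[ℝ] Y} {S : ℝ → Y →L[ℝ] Y}
    {R' A' : Z →L[ℝ] Z} {S' : ℝ → Z →L[ℝ] Z} (h : IsSmoothedGroup R A S)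
    (h' : IsSmoothedGroup R' A' S') :
    IsSmoothedGroup (R.prodMap R') (A.prodMap A') (fun t => (S t).prodMap (S' t)) where
  inj := h.inj.prodMap h'.inj
  dense := h.dense.prodMap h'.dense
  comm_R t y := Prod.ext (h.comm_R t y.1) (h'.comm_R t y.2)
  comm_A t y := Prod.ext (h.comm_A t y.1) (h'.comm_A t y.2)
  comm_RA y := Prod.ext (h.comm_RA y.1) (h'.comm_RA y.2)
  zero y := Prod.ext (h.zero y.1) (h'.zero y.2)
  neg_apply t y := Prod.ext (h.neg_apply t y.1) (h'.neg_apply t y.2)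
  norm_le t y := max_le_max (h.norm_le t y.1) (h'.norm_le t y.2)
  hasDerivAt t := by
    have := (ContinuousLinearMap.prodMapL ℝ Y Y Z Z).hasFDerivAt.comp_hasDerivAt t
      ((h.hasDerivAt t).prodMk (h'.hasDerivAt t))
    exact this

end FourierMultipliers

/-! ### The first-order system in `L²` and its characteristic coordinates -/

section System

variable {n : ℕ}

/-- The wave equation as a system for the `L²` representatives `f` of `u` and `g` of `∂_t u`. -/
structure IsLTwoSolution (a : ℝ → ℝ) (T : ℝ) (f g : ℝ → LTwo n) : Prop where
  continuousOn_fst : ContinuousOn f (Icc 0 T)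
  continuousOn_snd : ContinuousOn g (Icc 0 T)
  deriv_fst : ∀ t ∈ Icc 0 T, HasDerivWithinAt (fun τ => besselInv n (f τ)) (g t) (Icc 0 T) t
  deriv_snd : ∀ t ∈ Icc 0 T, HasDerivWithinAt (fun τ => besselInv n (g τ))
    (-(((2 * Real.pi : ℝ) : ℂ) ^ 2) • (f t - besselInv n (besselInv n (f t)))
      - (a t : ℂ) • besselInv n (g t)) (Icc 0 T) t

theorem real_smul_eq_coe_smul (c : ℝ) (x : LTwo n) : c • x = (c : ℂ) • x := by
  ext1
  filter_upwards [Lp.coeFn_smul c x, Lp.coeFn_smul (c : ℂ) x] with ξ h1 h2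
  rw [h1, h2, Pi.smul_apply, Pi.smul_apply, Complex.real_smul, smul_eq_mul]

theorem besselInv_smul (c : ℂ) (x : LTwo n) : besselInv n (c • x) = c • besselInv n x := by
  rw [← multL_const_apply, ← multL_const_apply, besselInv, multL_comm_apply]

theorem norm_besselInv_le (x : LTwo n) : ‖besselInv n x‖ ≤ ‖x‖ :=
  (norm_multL_apply_le _ _).trans (mul_le_of_le_one_left (norm_nonneg _)
    (BoundedContinuousFunction.norm_ofNormedAddCommGroup_le _ zero_le_one _))

/-- The characteristic coordinates `(g + i ν f, g - i ν f)`. -/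
def toChar (ν : ℝ) (f g : LTwo n) : LTwo n × LTwo n :=
  (g + (Complex.I * ν) • f, g + (Complex.I * (-ν : ℝ)) • f)

/-- Recovers `f` from the characteristic coordinates. -/
def charFst (n : ℕ) (ν : ℝ) : LTwo n × LTwo n →L[ℝ] LTwo n :=
  multL n (BoundedContinuousFunction.const _ (2 * Complex.I * ν)⁻¹) ∘L
    (ContinuousLinearMap.fst ℝ _ _ - ContinuousLinearMap.snd ℝ _ _)

/-- Recovers `g` from the characteristic coordinates. -/
def charSnd (n : ℕ) : LTwo n × LTwo n →L[ℝ] LTwo n :=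
  multL n (BoundedContinuousFunction.const _ 2⁻¹) ∘L
    (ContinuousLinearMap.fst ℝ _ _ + ContinuousLinearMap.snd ℝ _ _)

theorem charFst_apply (ν : ℝ) (y : LTwo n × LTwo n) :
    charFst n ν y = (2 * Complex.I * ν : ℂ)⁻¹ • (y.1 - y.2) := by
  exact multL_const_apply _ _

theorem charSnd_apply (y : LTwo n × LTwo n) : charSnd n y = (2 : ℂ)⁻¹ • (y.1 + y.2) := by
  exact multL_const_apply _ _

theorem charFst_toChar {ν : ℝ} (hν : ν ≠ 0) (f g : LTwo n) : charFst n ν (toChar ν f g) = f := by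
  have h : (ν : ℂ) ≠ 0 := by exact_mod_cast hν
  rw [charFst_apply, toChar]
  have : g + (Complex.I * ν) • f - (g + (Complex.I * (-ν : ℝ)) • f) =
      (2 * Complex.I * ν : ℂ) • f := by
    push_cast; module
  rw [this, smul_smul, inv_mul_cancel₀ (by simp [h]), one_smul]

theorem charSnd_toChar (ν : ℝ) (f g : LTwo n) : charSnd n (toChar ν f g) = g := by
  rw [charSnd_apply, toChar]
  push_cast; module

theorem toChar_char {ν : ℝ} (hν : ν ≠ 0) (y : LTwo n × LTwo n) :
    toChar ν (charFst n ν y) (charSnd n y) = y := by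
  have h : (ν : ℂ) ≠ 0 := by exact_mod_cast hν
  rw [charFst_apply, charSnd_apply, toChar, smul_smul, smul_smul]
  have h1 : Complex.I * ν * (2 * Complex.I * ν)⁻¹ = 2⁻¹ := by
    field_simp
  have h2 : Complex.I * (-ν : ℝ) * (2 * Complex.I * ν)⁻¹ = -2⁻¹ := by
    push_cast; field_simp
  rw [h1, h2]
  ext1 <;> simp only <;> module

/-- The lower order terms of the system in characteristic coordinates. -/
def lowerOrder (n : ℕ) (ν α : ℝ) : LTwo n × LTwo n →L[ℝ] LTwo n × LTwo n :=
  let h := ν ^ 2 • (besselInv n ∘L charFst n ν)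
  let k := charSnd n
  h.prod h - α • k.prod k

theorem lowerOrder_toChar {ν : ℝ} (hν : ν ≠ 0) (α : ℝ) (f g : LTwo n) :
    lowerOrder n ν α (toChar ν f g) =
      ((ν : ℂ) ^ 2 • besselInv n f - (α : ℂ) • g, (ν : ℂ) ^ 2 • besselInv n f - (α : ℂ) • g) := by
  simp only [lowerOrder, sub_apply, ContinuousLinearMap.prod_apply,
    ContinuousLinearMap.comp_apply, smul_apply, charFst_toChar hν, charSnd_toChar]
  rw [real_smul_eq_coe_smul]
  push_cast
  ext1 <;> simp only [Prod.fst_sub, Prod.snd_sub, Prod.smul_fst, Prod.smul_snd,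
    real_smul_eq_coe_smul α]

theorem lowerOrder_sub (ν α β : ℝ) :
    lowerOrder n ν α - lowerOrder n ν β = (β - α) • (charSnd n).prod (charSnd n) := by
  simp only [lowerOrder]
  module

theorem continuous_lowerOrder (ν : ℝ) : Continuous (lowerOrder n ν) := by
  unfold lowerOrder
  fun_prop

theorem isSmoothedGroup_char (n : ℕ) (ν : ℝ) : IsSmoothedGroup
    ((besselInv n).prodMap (besselInv n))
    ((multL n (BoundedContinuousFunction.const _ (Complex.I * ν))).prodMap
      (multL n (BoundedContinuousFunction.const _ (Complex.I * (-ν : ℝ)))))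
    (fun t => (multL n (waveSymbol n ν t)).prodMap (multL n (waveSymbol n (-ν) t))) :=
  (isSmoothedGroup_wave ν).prodMap (isSmoothedGroup_wave (-ν))

/-- The diagonal form is equivalent to the system because `(± iν)(g ± iν f) = ± iν g - ν² f`; the
term `ν² R² f` and the dissipation are of lower order. -/
theorem charVectorField_eq {ν : ℝ} (hν : ν ≠ 0) (α : ℝ) (f g : LTwo n) :
    (multL n (BoundedContinuousFunction.const _ (Complex.I * ν))).prodMap
      (multL n (BoundedContinuousFunction.const _ (Complex.I * (-ν : ℝ)))) (toChar ν f g)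
      + (besselInv n).prodMap (besselInv n) (lowerOrder n ν α (toChar ν f g)) =
    toChar ν g (-((ν : ℂ) ^ 2) • (f - besselInv n (besselInv n f)) - (α : ℂ) • besselInv n g) := by
  rw [lowerOrder_toChar hν]
  simp only [toChar]
  ext1
  · simp only [ContinuousLinearMap.coe_prodMap', Prod.map_apply, Prod.fst_add,
      multL_const_apply, map_sub, besselInv_smul]
    match_scalars <;> ring_nf
    simp
  · simp only [ContinuousLinearMap.coe_prodMap', Prod.map_apply, Prod.snd_add,
      multL_const_apply, map_sub, besselInv_smul]
    match_scalars <;> ring_nf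
    simp

namespace IsLTwoSolution

variable {a : ℝ → ℝ} {T : ℝ} {f g : ℝ → LTwo n}

theorem toChar_continuousOn (h : IsLTwoSolution a T f g) :
    ContinuousOn (fun t => toChar (2 * Real.pi) (f t) (g t)) (Icc 0 T) := by
  have h1 (c : ℂ) : ContinuousOn (fun t => g t + c • f t) (Icc 0 T) :=
    h.continuousOn_snd.add (h.continuousOn_fst.const_smul c)
  exact (h1 _).prodMk (h1 _)

theorem toChar_hasDerivWithinAt (h : IsLTwoSolution a T f g) {t : ℝ} (ht : t ∈ Icc 0 T) :
    HasDerivWithinAt (fun τ => (besselInv n).prodMap (besselInv n)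
        (toChar (2 * Real.pi) (f τ) (g τ)))
      ((multL n (BoundedContinuousFunction.const _ (Complex.I * (2 * Real.pi : ℝ)))).prodMap
        (multL n (BoundedContinuousFunction.const _ (Complex.I * (-(2 * Real.pi) : ℝ))))
        (toChar (2 * Real.pi) (f t) (g t))
        + (besselInv n).prodMap (besselInv n)
          (lowerOrder n (2 * Real.pi) (a t) (toChar (2 * Real.pi) (f t) (g t))))
      (Icc 0 T) t := by
  rw [charVectorField_eq (by positivity)]
  have h1 := h.deriv_fst t ht
  have h2 := h.deriv_snd t ht
  refine ((h2.add (h1.const_smul (Complex.I * (2 * Real.pi : ℝ)))).prodMk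
    (h2.add (h1.const_smul (Complex.I * (-(2 * Real.pi) : ℝ))))).congr (fun τ _ => ?_) ?_ <;>
  · simp [toChar, besselInv_smul]

theorem of_char {U : ℝ → LTwo n × LTwo n} (hU : ContinuousOn U (Icc 0 T))
    (hd : ∀ t ∈ Icc 0 T, HasDerivWithinAt (fun τ => (besselInv n).prodMap (besselInv n) (U τ))
      ((multL n (BoundedContinuousFunction.const _ (Complex.I * (2 * Real.pi : ℝ)))).prodMap
        (multL n (BoundedContinuousFunction.const _ (Complex.I * (-(2 * Real.pi) : ℝ)))) (U t)
        + (besselInv n).prodMap (besselInv n) (lowerOrder n (2 * Real.pi) (a t) (U t)))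
      (Icc 0 T) t) :
    IsLTwoSolution a T (fun t => charFst n (2 * Real.pi) (U t)) (fun t => charSnd n (U t)) := by
  have hpi : (2 * Real.pi : ℝ) ≠ 0 := by positivity
  have hd' : ∀ t ∈ Icc 0 T, HasDerivWithinAt
      (fun τ => (besselInv n).prodMap (besselInv n) (U τ))
      (toChar (2 * Real.pi) (charSnd n (U t)) (-(((2 * Real.pi : ℝ) : ℂ) ^ 2) •
        (charFst n (2 * Real.pi) (U t) - besselInv n (besselInv n (charFst n (2 * Real.pi) (U t))))
          - (a t : ℂ) • besselInv n (charSnd n (U t)))) (Icc 0 T) t := fun t ht => by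
    have := hd t ht
    rw [← toChar_char hpi (U t), charVectorField_eq hpi] at this
    exact this
  refine ⟨(charFst n _).continuous.comp_continuousOn hU, (charSnd n).continuous.comp_continuousOn hU,
    fun t ht => ?_, fun t ht => ?_⟩
  · have := (charFst n (2 * Real.pi)).hasFDerivAt.comp_hasDerivWithinAt t (hd' t ht)
    rw [charFst_toChar hpi] at this
    refine this.congr (fun τ _ => ?_) ?_ <;>
    simp [charFst_apply, besselInv_smul]
  · have := (charSnd n).hasFDerivAt.comp_hasDerivWithinAt t (hd' t ht)
    rw [charSnd_toChar] at this
    refine this.congr (fun τ _ => ?_) ?_ <;>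
    simp [charSnd_apply, besselInv_smul]

theorem exists_of_initial (hT : 0 < T) (ha : ContinuousOn a (Icc 0 T)) (f₀ g₀ : LTwo n) :
    ∃ f g : ℝ → LTwo n, f 0 = f₀ ∧ g 0 = g₀ ∧ IsLTwoSolution a T f g := by
  obtain ⟨U, hU0, hU, hd⟩ := (isSmoothedGroup_char n (2 * Real.pi)).exists_solution hT.le
    ((continuous_lowerOrder (2 * Real.pi)).comp_continuousOn ha) (toChar (2 * Real.pi) f₀ g₀)
  refine ⟨_, _, ?_, ?_, of_char hU hd⟩
  · rw [hU0, charFst_toChar (by positivity)]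
  · rw [hU0, charSnd_toChar]

/-- Continuous dependence of the solution on the coefficient of the dissipation. -/
theorem stability (h : IsLTwoSolution a T f g) (hT : 0 < T) (ha : ContinuousOn a (Icc 0 T))
    {η : ℝ} (hη : 0 < η) :
    ∃ δ : ℝ, 0 < δ ∧ ∀ (a' : ℝ → ℝ) (f' g' : ℝ → LTwo n), ContinuousOn a' (Icc 0 T) →
      IsLTwoSolution a' T f' g' → f' 0 = f 0 → g' 0 = g 0 →
      (∀ t ∈ Icc 0 T, |a' t - a t| ≤ δ) →
      ∀ t ∈ Icc 0 T, ‖f' t - f t‖ ≤ η ∧ ‖g' t - g t‖ ≤ η := by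
  have hpi : (2 * Real.pi : ℝ) ≠ 0 := by positivity
  have hL := (continuous_lowerOrder (n := n) (2 * Real.pi)).comp_continuousOn ha
  obtain ⟨M, hM⟩ := isCompact_Icc.exists_bound_of_continuousOn hL
  obtain ⟨D, hD⟩ := isCompact_Icc.exists_bound_of_continuousOn h.toChar_continuousOn
  set K : ℝ := ‖(charSnd n).prod (charSnd n)‖ with hK
  -- A common bound for the two maps back to `f` and `g`; the summand `1` keeps it positive for the
  -- division.
  set C : ℝ := ‖charFst n (2 * Real.pi)‖ + ‖charSnd n‖ + 1 with hC
  have hC0 : 0 < C := by positivity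
  have hM0 : 0 ≤ M := (norm_nonneg _).trans (hM 0 ⟨le_rfl, hT.le⟩)
  -- `M + K` bounds the perturbed coefficients for every `δ ≤ 1`, so the Gronwall constant is fixed
  -- while its source term tends to zero.
  have hcont : Tendsto (fun δ : ℝ => gronwallBound 0 (M + K) (δ * K * D) T) (𝓝[>] 0) (𝓝 0) := by
    have h1 : Continuous (fun δ : ℝ => gronwallBound 0 (M + K) (δ * K * D) T) :=
      (gronwallBound_continuous_ε 0 (M + K) T).comp (by fun_prop)
    have h2 := h1.tendsto 0
    simp only [zero_mul, gronwallBound_ε0_δ0] at h2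
    exact h2.mono_left nhdsWithin_le_nhds
  obtain ⟨δ, hδ, hδ0, hδ1⟩ := ((hcont.eventually_le_const (show (0 : ℝ) < η / C by positivity)).and
    (Ioc_mem_nhdsGT (zero_lt_one' ℝ))).exists
  refine ⟨δ, hδ0, fun a' f' g' ha' h' hf0 hg0 hda => ?_⟩
  have hsub : ∀ t ∈ Icc 0 T, ‖lowerOrder n (2 * Real.pi) (a' t) - lowerOrder n (2 * Real.pi) (a t)‖
      ≤ δ * K := fun t ht => by
    rw [lowerOrder_sub, norm_smul, Real.norm_eq_abs, abs_sub_comm]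
    gcongr
    exact hda t ht
  -- The reference solution is put in the slot whose size enters, so that `D`, and hence `δ`, does
  -- not depend on the perturbed solution.
  have key := (isSmoothedGroup_char n (2 * Real.pi)).norm_sub_le (M := M + K) (δ := δ * K) (D := D)
    (F := fun t => lowerOrder n (2 * Real.pi) (a' t))
    (F' := fun t => lowerOrder n (2 * Real.pi) (a t)) (by positivity)
    (fun t ht => by
      have h1 := norm_le_norm_add_norm_sub' (lowerOrder n (2 * Real.pi) (a' t))
        (lowerOrder n (2 * Real.pi) (a t))
      have h2 : δ * K ≤ K := mul_le_of_le_one_left (norm_nonneg _) hδ1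
      have h3 : ‖lowerOrder n (2 * Real.pi) (a t)‖ ≤ M := hM t ht
      linarith [hsub t ht])
    ((continuous_lowerOrder (2 * Real.pi)).comp_continuousOn ha') hL h'.toChar_continuousOn
    h.toChar_continuousOn (fun t ht => h'.toChar_hasDerivWithinAt ht)
    (fun t ht => h.toChar_hasDerivWithinAt ht) hD hsub (by rw [hf0, hg0])
  intro t ht
  have hb := (key t ht).trans hδ
  have e1 : f' t - f t = charFst n (2 * Real.pi)
      (toChar (2 * Real.pi) (f' t) (g' t) - toChar (2 * Real.pi) (f t) (g t)) := by
    rw [map_sub, charFst_toChar hpi, charFst_toChar hpi]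
  have e2 : g' t - g t = charSnd n
      (toChar (2 * Real.pi) (f' t) (g' t) - toChar (2 * Real.pi) (f t) (g t)) := by
    rw [map_sub, charSnd_toChar, charSnd_toChar]
  constructor
  · rw [e1]
    calc _ ≤ ‖charFst n (2 * Real.pi)‖ * (η / C) :=
          ContinuousLinearMap.le_of_opNorm_le_of_le _ le_rfl hb
      _ ≤ C * (η / C) := by gcongr; linarith [norm_nonneg (charSnd n)]
      _ = η := by field_simp
  · rw [e2]
    calc _ ≤ ‖charSnd n‖ * (η / C) := ContinuousLinearMap.le_of_opNorm_le_of_le _ le_rfl hb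
      _ ≤ C * (η / C) := by gcongr; linarith [norm_nonneg (charFst n (2 * Real.pi))]
      _ = η := by field_simp

theorem eqOn (h : IsLTwoSolution a T f g) {f' g' : ℝ → LTwo n} (h' : IsLTwoSolution a T f' g')
    (hT : 0 < T) (ha : ContinuousOn a (Icc 0 T)) (hf : f' 0 = f 0) (hg : g' 0 = g 0) :
    EqOn f' f (Icc 0 T) := by
  intro t ht
  refine eq_of_forall_dist_le fun η hη => ?_
  obtain ⟨δ, hδ, H⟩ := h.stability hT ha hη
  rw [dist_eq_norm]
  exact (H a f' g' ha h' hf hg (fun t _ => by simp [hδ.le]) t ht).1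

end IsLTwoSolution

end System

/-! ### Passage between Sobolev solutions and the `L²` system -/

section Sobolev

variable {n : ℕ}

section Representation

theorem toDist_toSobolev {r : ℝ} {u : TempDist n} (h : MemSobolev r 2 u) :
    SobolevSpace.toDist (toSobolev r u) = u := by
  have h1 : toSobolev r u = ⟨u, h⟩ := dif_pos h
  rw [h1]; rfl

theorem toSobolev_toDist {r : ℝ} (v : SobolevSpace n r) :
    toSobolev r (SobolevSpace.toDist v) = v :=
  SobolevSpace.toDist_injective (toDist_toSobolev (SobolevSpace.memSobolev_toDist v))

theorem besselLp_surjective (r : ℝ) :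
    Function.Surjective (SobolevSpace.besselLpₗ (n := n) (r := r)) := by
  intro x
  have hx : besselPotential (EuclideanSpace ℝ (Fin n)) ℂ r
      (besselPotential (EuclideanSpace ℝ (Fin n)) ℂ (-r) (x : TempDist n)) = x := by simp
  have hm : MemSobolev r 2
      (besselPotential (EuclideanSpace ℝ (Fin n)) ℂ (-r) (x : TempDist n)) := ⟨x, hx⟩
  refine ⟨toSobolev r (besselPotential (EuclideanSpace ℝ (Fin n)) ℂ (-r) (x : TempDist n)),
    SobolevSpace.coe_Lp_injective ?_⟩
  refine (SobolevSpace.besselLp_spec _).symm.trans ?_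
  rw [toDist_toSobolev hm, hx]

/-- The Bessel potential of order `r` as an isometric isomorphism from `H^r` onto `L²`. -/
def besselEquiv (n : ℕ) (r : ℝ) : SobolevSpace n r ≃ₗᵢ[ℂ] LTwo n where
  toLinearEquiv := LinearEquiv.ofBijective SobolevSpace.besselLpₗ
    ⟨SobolevSpace.besselLpₗ_injective, besselLp_surjective r⟩
  norm_map' _ := rfl

theorem besselEquiv_spec {r : ℝ} (v : SobolevSpace n r) :
    besselPotential (EuclideanSpace ℝ (Fin n)) ℂ r (SobolevSpace.toDist v) =
      (besselEquiv n r v : LTwo n) :=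
  SobolevSpace.besselLp_spec v

/-- `besselEquiv` as a continuous `ℝ`-linear map. -/
def besselCLM (n : ℕ) (r : ℝ) : SobolevSpace n r →L[ℝ] LTwo n :=
  LinearMap.mkContinuous
    { toFun := besselEquiv n r
      map_add' := map_add _
      map_smul' := fun c v => by
        rw [RingHom.id_apply, real_smul_eq_coe_smul, ← map_smul]; rfl } 1
    fun v => by rw [one_mul]; exact ((besselEquiv n r).norm_map v).le

/-- The inverse of `besselCLM`. -/
def besselSymmCLM (n : ℕ) (r : ℝ) : LTwo n →L[ℝ] SobolevSpace n r :=
  LinearMap.mkContinuous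
    { toFun := (besselEquiv n r).symm
      map_add' := map_add _
      map_smul' := fun c v => by
        rw [RingHom.id_apply, real_smul_eq_coe_smul, map_smul]; rfl } 1
    fun v => by rw [one_mul]; exact ((besselEquiv n r).symm.norm_map v).le

theorem besselSymmCLM_apply {r : ℝ} (x : LTwo n) :
    besselSymmCLM n r x = (besselEquiv n r).symm x := rfl

theorem besselEquiv_toSobolev_sub_one {s : ℝ} {u : TempDist n} (h : MemSobolev s 2 u) :
    besselEquiv n (s - 1) (toSobolev (s - 1) u) = besselInv n (besselEquiv n s (toSobolev s u)) := by
  apply SobolevSpace.coe_Lp_injective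
  rw [← besselEquiv_spec, toDist_toSobolev (h.mono (by linarith)), toTempDist_besselInv,
    ← besselEquiv_spec, toDist_toSobolev h, besselPotential_besselPotential_apply,
    sub_eq_add_neg]

theorem toTempDist_sub (x y : LTwo n) : ((x - y : LTwo n) : TempDist n) = x - y :=
  map_sub (Lp.toTemperedDistributionCLM ℂ (volume : Measure (EuclideanSpace ℝ (Fin n))) 2) x y

theorem toTempDist_smul (c : ℂ) (x : LTwo n) : ((c • x : LTwo n) : TempDist n) = c • x :=
  map_smul (Lp.toTemperedDistributionCLM ℂ (volume : Measure (EuclideanSpace ℝ (Fin n))) 2) c x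

/-- On the symbol side, `‖ξ‖² / (1 + ‖ξ‖²) = 1 - (1 + ‖ξ‖²)^(-1)`; the factor `(2π)²` comes from the
normalisation of the Fourier transform. -/
theorem besselPotential_neg_two_laplacian (u : TempDist n) :
    besselPotential (EuclideanSpace ℝ (Fin n)) ℂ (-2) (Δ u) =
      -(((2 * Real.pi : ℝ) : ℂ) ^ 2) •
        (u - besselPotential (EuclideanSpace ℝ (Fin n)) ℂ (-2) u) := by
  rw [besselPotential_neg_two_laplacian_eq]
  set g : EuclideanSpace ℝ (Fin n) → ℂ := fun x => (((1 + ‖x‖ ^ 2) ^ (-2 / 2 : ℝ) : ℝ) : ℂ) with hg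
  have hgt : Function.HasTemperateGrowth g := by fun_prop
  have h1 : (fun x : EuclideanSpace ℝ (Fin n) =>
      Complex.ofReal (‖x‖ ^ 2 * (1 + ‖x‖ ^ 2) ^ (-1 : ℝ))) = (fun _ => (1 : ℂ)) - g := by
    ext x
    have hx : (1 + ‖x‖ ^ 2 : ℝ) ≠ 0 := by positivity
    rw [Pi.sub_apply, hg]
    norm_num [Real.rpow_neg_one]
    have hx' : (1 + ‖x‖ ^ 2 : ℂ) ≠ 0 := by exact_mod_cast hx
    field_simp
    ring
  have h2 : fourierMultiplierCLM ℂ ((fun _ => (1 : ℂ)) - g) u =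
      u - besselPotential (EuclideanSpace ℝ (Fin n)) ℂ (-2) u := by
    rw [fourierMultiplierCLM_apply, smulLeftCLM_sub (by fun_prop) hgt,
      sub_apply, sub_eq_add_neg, FourierTransform.fourierInv_add,
      FourierTransform.fourierInv_neg, smulLeftCLM_const, one_smul,
      FourierTransform.fourierInv_fourier_eq, ← sub_eq_add_neg]
    rfl
  rw [h1, h2]
  ext φ
  simp only [smul_apply, Complex.real_smul, smul_eq_mul]
  push_cast
  rfl

theorem besselPotential_laplacian {s : ℝ} {u : TempDist n} (h : MemSobolev s 2 u) :
    besselPotential (EuclideanSpace ℝ (Fin n)) ℂ (s - 2) (Δ u) =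
      ((-(((2 * Real.pi : ℝ) : ℂ) ^ 2) • (besselEquiv n s (toSobolev s u) -
        besselInv n (besselInv n (besselEquiv n s (toSobolev s u)))) : LTwo n) : TempDist n) := by
  have h1 : besselPotential (EuclideanSpace ℝ (Fin n)) ℂ (s - 2) (Δ u) =
      besselPotential (EuclideanSpace ℝ (Fin n)) ℂ s
        (besselPotential (EuclideanSpace ℝ (Fin n)) ℂ (-2) (Δ u)) := by
    rw [besselPotential_besselPotential_apply]; congr 2; ring
  rw [h1, besselPotential_neg_two_laplacian, toTempDist_smul, toTempDist_sub,
    toTempDist_besselInv, toTempDist_besselInv, ← besselEquiv_spec, toDist_toSobolev h,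
    map_smul, map_sub]
  simp only [besselPotential_besselPotential_apply]
  congr 4; ring

theorem besselPotential_sub_two_toDist {s : ℝ} (v : SobolevSpace n (s - 1)) :
    besselPotential (EuclideanSpace ℝ (Fin n)) ℂ (s - 2) (SobolevSpace.toDist v) =
      (besselInv n (besselEquiv n (s - 1) v) : LTwo n) := by
  rw [toTempDist_besselInv, ← besselEquiv_spec, besselPotential_besselPotential_apply]
  congr 2; ring

/-- The potential acts on distributions by duality, so it only changes the test function. -/
theorem hasDerivWithinAt_besselPotential (r : ℝ) {v : ℝ → TempDist n} {w : TempDist n} {I : Set ℝ}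
    {t : ℝ} (h : ∀ φ : 𝓢(EuclideanSpace ℝ (Fin n), ℂ),
      HasDerivWithinAt (fun τ => v τ φ) (w φ) I t) (φ : 𝓢(EuclideanSpace ℝ (Fin n), ℂ)) :
    HasDerivWithinAt (fun τ => besselPotential (EuclideanSpace ℝ (Fin n)) ℂ r (v τ) φ)
      (besselPotential (EuclideanSpace ℝ (Fin n)) ℂ r w φ) I t :=
  h _

/-- Evaluation of elements of `L²` on Schwartz functions. -/
def evalLTwo (φ : 𝓢(EuclideanSpace ℝ (Fin n), ℂ)) : LTwo n →L[ℝ] ℂ :=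
  ((PointwiseConvergenceCLM.evalCLM _ ℂ φ) ∘L
    (Lp.toTemperedDistributionCLM ℂ (volume : Measure (EuclideanSpace ℝ (Fin n))) 2)).restrictScalars ℝ

theorem eq_zero_of_evalLTwo {x : LTwo n} (h : ∀ φ, evalLTwo φ x = 0) : x = 0 := by
  apply SobolevSpace.coe_Lp_injective
  have h0 : ((0 : LTwo n) : TempDist n) = 0 :=
    map_zero (Lp.toTemperedDistributionCLM ℂ (volume : Measure (EuclideanSpace ℝ (Fin n))) 2)
  rw [h0]
  ext φ
  exact h φ

end Representation

section Solutions

variable {a : ℝ → ℝ} {s T : ℝ} {u₀ u₁ : TempDist n} {u : ℝ → TempDist n}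

theorem timeDeriv_one {r : ℝ} {I : Set ℝ} (t : ℝ) :
    timeDeriv 1 r I u t = derivWithin (fun τ => toSobolev r (u τ)) I t := by
  rw [timeDeriv, iteratedDerivWithin_one]

theorem MemCk.hasDerivWithinAt {r : ℝ} {I : Set ℝ} (h : MemCk 1 r I u) {t : ℝ} (ht : t ∈ I) :
    HasDerivWithinAt (fun τ => toSobolev r (u τ)) (timeDeriv 1 r I u t) I t := by
  rw [timeDeriv_one]
  exact (h.2.differentiableOn (by simp) t ht).hasDerivWithinAt

theorem MemCk.continuousOn_timeDeriv {r : ℝ} {I : Set ℝ} (h : MemCk 1 r I u)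
    (hI : UniqueDiffOn ℝ I) : ContinuousOn (timeDeriv 1 r I u) I :=
  h.2.continuousOn_iteratedDerivWithin (by simp) hI

theorem besselPotential_waveOperator {w : TempDist n} (hw : MemSobolev s 2 w)
    (v : SobolevSpace n (s - 1)) (α : ℂ) :
    besselPotential (EuclideanSpace ℝ (Fin n)) ℂ (s - 2) (Δ w - α • SobolevSpace.toDist v) =
    ((-(((2 * Real.pi : ℝ) : ℂ) ^ 2) • (besselEquiv n s (toSobolev s w) -
      besselInv n (besselInv n (besselEquiv n s (toSobolev s w))))
      - α • besselInv n (besselEquiv n (s - 1) v) : LTwo n) : TempDist n) := by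
  rw [map_sub, map_smul, besselPotential_laplacian hw, besselPotential_sub_two_toDist,
    toTempDist_sub _ (α • _), toTempDist_smul α]

theorem continuousOn_waveOperator {f g : ℝ → LTwo n} {I : Set ℝ} (hf : ContinuousOn f I)
    (hg : ContinuousOn g I) (ha : ContinuousOn a I) (c : ℂ) :
    ContinuousOn (fun t => c • (f t - besselInv n (besselInv n (f t)))
      - (a t : ℂ) • besselInv n (g t)) I := by
  have hR : Continuous (besselInv n) := (besselInv n).continuous
  have h1 : ContinuousOn (fun t => besselInv n (besselInv n (f t))) I :=
    hR.comp_continuousOn (hR.comp_continuousOn hf)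
  have h2 : ContinuousOn (fun t => c • (f t - besselInv n (besselInv n (f t)))) I :=
    (hf.sub h1).const_smul c
  have h3 : ContinuousOn (fun t => besselInv n (g t)) I := hR.comp_continuousOn hg
  have h4 : ContinuousOn (fun t => (a t : ℂ)) I := Complex.continuous_ofReal.comp_continuousOn ha
  exact h2.sub (h4.smul h3)

/-- The distributional equation, lifted by `J^(s-2)`, has a right-hand side that is continuous into
`L²`. Evaluations on Schwartz functions separate `L²`, so the weak time derivative is a strong one.
-/
theorem IsSobolevSolution.isLTwoSolution (h : IsSobolevSolution (Icc 0 T) a s u₀ u₁ u)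
    (hT : 0 < T) (ha : ContinuousOn a (Icc 0 T)) :
    IsLTwoSolution a T (fun t => besselEquiv n s (toSobolev s (u t)))
      (fun t => besselEquiv n (s - 1) (timeDeriv 1 (s - 1) (Icc 0 T) u t)) := by
  have hf : ContinuousOn (fun t => besselEquiv n s (toSobolev s (u t))) (Icc 0 T) :=
    (besselCLM n s).continuous.comp_continuousOn h.memC0.2.continuousOn
  have hg : ContinuousOn (fun t => besselEquiv n (s - 1) (timeDeriv 1 (s - 1) (Icc 0 T) u t))
      (Icc 0 T) := (besselCLM n (s - 1)).continuous.comp_continuousOn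
    (h.memC1.continuousOn_timeDeriv (uniqueDiffOn_Icc hT))
  refine ⟨hf, hg, fun t ht => ?_, ?_⟩
  · have h1 := (besselCLM n (s - 1)).hasFDerivAt.comp_hasDerivWithinAt t
      (h.memC1.hasDerivWithinAt ht)
    exact h1.congr (fun τ hτ => (besselEquiv_toSobolev_sub_one (h.memC0.1 τ hτ)).symm)
      (besselEquiv_toSobolev_sub_one (h.memC0.1 t ht)).symm
  · refine hasDerivWithinAt_of_separating evalLTwo (fun x hx => eq_zero_of_evalLTwo hx) ?_ ?_
    · exact continuousOn_waveOperator hf hg ha _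
    · intro t ht φ
      have h1 := hasDerivWithinAt_besselPotential (s - 2)
        (v := fun τ => SobolevSpace.toDist (timeDeriv 1 (s - 1) (Icc 0 T) u τ))
        (w := Δ (u t) - (a t : ℂ) • SobolevSpace.toDist (timeDeriv 1 (s - 1) (Icc 0 T) u t))
        (h.equation t ht) φ
      rw [besselPotential_waveOperator (h.memC0.1 t ht)] at h1
      simp only [besselPotential_sub_two_toDist] at h1
      exact h1

theorem memCk_of_isLTwoSolution {f g : ℝ → LTwo n} (h : IsLTwoSolution a T f g) (hT : 0 < T) :
    MemCk 1 (s - 1) (Icc 0 T) (fun t => SobolevSpace.toDist ((besselEquiv n s).symm (f t))) ∧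
    ∀ t ∈ Icc 0 T, timeDeriv 1 (s - 1) (Icc 0 T)
      (fun t => SobolevSpace.toDist ((besselEquiv n s).symm (f t))) t =
        (besselEquiv n (s - 1)).symm (g t) := by
  set u : ℝ → TempDist n := fun t => SobolevSpace.toDist ((besselEquiv n s).symm (f t)) with hu
  have hm : ∀ t, MemSobolev s 2 (u t) := fun t => SobolevSpace.memSobolev_toDist _
  have hr : ∀ t, toSobolev (s - 1) (u t) = besselSymmCLM n (s - 1) (besselInv n (f t)) := by
    intro t
    rw [besselSymmCLM_apply, LinearIsometryEquiv.eq_symm_apply,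
      besselEquiv_toSobolev_sub_one (hm t), hu, toSobolev_toDist,
      LinearIsometryEquiv.apply_symm_apply]
  have hd : ∀ t ∈ Icc 0 T, HasDerivWithinAt (fun τ => toSobolev (s - 1) (u τ))
      (besselSymmCLM n (s - 1) (g t)) (Icc 0 T) t := fun t ht =>
    ((besselSymmCLM n (s - 1)).hasFDerivAt.comp_hasDerivWithinAt t (h.deriv_fst t ht)).congr
      (fun τ _ => hr τ) (hr t)
  have hd' : ∀ t ∈ Icc 0 T, derivWithin (fun τ => toSobolev (s - 1) (u τ)) (Icc 0 T) t =
      besselSymmCLM n (s - 1) (g t) := fun t ht =>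
    (hd t ht).derivWithin (uniqueDiffOn_Icc hT t ht)
  refine ⟨⟨fun t _ => (hm t).mono (by linarith), ?_⟩, fun t ht => ?_⟩
  · rw [Nat.cast_one, contDiffOn_one_iff_derivWithin (uniqueDiffOn_Icc hT)]
    exact ⟨fun t ht => (hd t ht).differentiableWithinAt,
      ((besselSymmCLM n (s - 1)).continuous.comp_continuousOn h.continuousOn_snd).congr hd'⟩
  · rw [timeDeriv_one, hd' t ht, besselSymmCLM_apply]

theorem IsLTwoSolution.isSobolevSolution {f g : ℝ → LTwo n} (h : IsLTwoSolution a T f g)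
    (hT : 0 < T) : IsSobolevSolution (Icc 0 T) a s
      (SobolevSpace.toDist ((besselEquiv n s).symm (f 0)))
      (SobolevSpace.toDist ((besselEquiv n (s - 1)).symm (g 0)))
      (fun t => SobolevSpace.toDist ((besselEquiv n s).symm (f t))) where
  memC0 := by
    refine ⟨fun t _ => SobolevSpace.memSobolev_toDist _, ?_⟩
    simp only [toSobolev_toDist]
    exact contDiffOn_zero.mpr
      ((besselSymmCLM n s).continuous.comp_continuousOn h.continuousOn_fst)
  memC1 := (memCk_of_isLTwoSolution h hT).1
  equation t ht φ := by
    have hD := (memCk_of_isLTwoSolution (s := s) h hT).2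
    have hφ : ∀ φ : 𝓢(EuclideanSpace ℝ (Fin n), ℂ), HasDerivWithinAt
        (fun τ => besselPotential (EuclideanSpace ℝ (Fin n)) ℂ (s - 2)
          (SobolevSpace.toDist ((besselEquiv n (s - 1)).symm (g τ))) φ)
        (besselPotential (EuclideanSpace ℝ (Fin n)) ℂ (s - 2)
          (Δ (SobolevSpace.toDist ((besselEquiv n s).symm (f t))) - (a t : ℂ) •
            SobolevSpace.toDist ((besselEquiv n (s - 1)).symm (g t))) φ) (Icc 0 T) t := by
      intro φ
      rw [besselPotential_waveOperator (SobolevSpace.memSobolev_toDist _)]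
      simp only [besselPotential_sub_two_toDist, toSobolev_toDist,
        LinearIsometryEquiv.apply_symm_apply]
      exact (evalLTwo φ).hasFDerivAt.comp_hasDerivWithinAt t (h.deriv_snd t ht)
    -- The lift by `J^(s-2)` is undone to recover the equation for `u` itself.
    have h2 := hasDerivWithinAt_besselPotential (-(s - 2)) hφ φ
    simp only [besselPotential_besselPotential_apply, add_neg_cancel, besselPotential_zero,
      ContinuousLinearMap.id_apply] at h2
    rw [hD t ht]
    exact h2.congr (fun τ hτ => by rw [hD τ hτ]) (by rw [hD t ht])
  initial := rfl
  initial_deriv := by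
    rw [(memCk_of_isLTwoSolution (s := s) h hT).2 0 ⟨le_rfl, hT.le⟩]

theorem MemCk.mono {k : ℕ} {r : ℝ} {I J : Set ℝ} (h : MemCk k r I u) (hJ : J ⊆ I) :
    MemCk k r J u :=
  ⟨fun t ht => h.1 t (hJ ht), h.2.mono hJ⟩

/-- The point to check is that the time derivative within `[0,T]` agrees with the one within
`[0,∞)`, also at the end point `T`. -/
theorem IsSobolevSolution.restrict (h : IsSobolevSolution (Ici 0) a s u₀ u₁ u) (hT : 0 < T) :
    IsSobolevSolution (Icc 0 T) a s u₀ u₁ u := by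
  have hsub : Icc 0 T ⊆ Ici (0 : ℝ) := Icc_subset_Ici_self
  have hD : ∀ t ∈ Icc 0 T, timeDeriv 1 (s - 1) (Icc 0 T) u t = timeDeriv 1 (s - 1) (Ici 0) u t := by
    intro t ht
    rw [timeDeriv_one]
    exact ((h.memC1.hasDerivWithinAt (hsub ht)).mono hsub).derivWithin (uniqueDiffOn_Icc hT t ht)
  refine ⟨h.memC0.mono hsub, h.memC1.mono hsub, fun t ht φ => ?_, h.initial, ?_⟩
  · rw [hD t ht]
    exact ((h.equation t (hsub ht) φ).mono hsub).congr (fun τ hτ => by rw [hD τ hτ])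
      (by rw [hD t ht])
  · rw [hD 0 ⟨le_rfl, hT.le⟩, h.initial_deriv]

theorem IsSobolevSolution.besselEquiv_initial (h : IsSobolevSolution (Icc 0 T) a s u₀ u₁ u)
    {v : ℝ → TempDist n} {a' : ℝ → ℝ} (h' : IsSobolevSolution (Icc 0 T) a' s u₀ u₁ v) :
    besselEquiv n s (toSobolev s (v 0)) = besselEquiv n s (toSobolev s (u 0)) ∧
    besselEquiv n (s - 1) (timeDeriv 1 (s - 1) (Icc 0 T) v 0) =
      besselEquiv n (s - 1) (timeDeriv 1 (s - 1) (Icc 0 T) u 0) := by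
  constructor
  · rw [h.initial, h'.initial]
  · congr 1
    apply SobolevSpace.toDist_injective
    rw [h.initial_deriv, h'.initial_deriv]

theorem exists_isSobolevSolution (hT : 0 < T) (ha : ContinuousOn a (Icc 0 T))
    (hu₀ : MemSobolev s 2 u₀) (hu₁ : MemSobolev (s - 1) 2 u₁) :
    ∃ v, IsSobolevSolution (Icc 0 T) a s u₀ u₁ v := by
  obtain ⟨f, g, hf, hg, h⟩ := IsLTwoSolution.exists_of_initial hT ha
    (besselEquiv n s (toSobolev s u₀)) (besselEquiv n (s - 1) (toSobolev (s - 1) u₁))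
  have := h.isSobolevSolution (s := s) hT
  rw [hf, hg, LinearIsometryEquiv.symm_apply_apply, LinearIsometryEquiv.symm_apply_apply,
    toDist_toSobolev hu₀, toDist_toSobolev hu₁] at this
  exact ⟨_, this⟩

theorem IsSobolevSolution.eqOn (h : IsSobolevSolution (Icc 0 T) a s u₀ u₁ u) (hT : 0 < T)
    (ha : ContinuousOn a (Icc 0 T)) {v : ℝ → TempDist n}
    (h' : IsSobolevSolution (Icc 0 T) a s u₀ u₁ v) : EqOn v u (Icc 0 T) := by
  intro t ht
  have h0 := h.besselEquiv_initial h'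
  have h1 := (h.isLTwoSolution hT ha).eqOn (h'.isLTwoSolution hT ha) hT ha h0.1 h0.2 ht
  rw [← toDist_toSobolev (h.memC0.1 t ht), ← toDist_toSobolev (h'.memC0.1 t ht),
    (besselEquiv n s).injective h1]

theorem convergesInSobolev_of_tendstoUniformlyOn (hT : 0 < T) (ha : ContinuousOn a (Icc 0 T))
    {v : ℝ → TempDist n} (hv : IsSobolevSolution (Icc 0 T) a s u₀ u₁ v) {aε : ℝ → ℝ → ℝ}
    {uε : ℝ → ℝ → TempDist n} (haε : ∀ᶠ ε in 𝓝[>] 0, ContinuousOn (aε ε) (Icc 0 T))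
    (hu : ∀ ε ∈ Ioc (0 : ℝ) 1, IsSobolevSolution (Icc 0 T) (aε ε) s u₀ u₁ (uε ε))
    (hlim : TendstoUniformlyOn aε a (𝓝[>] 0) (Icc 0 T)) : ConvergesInSobolev s T uε v := by
  have hIoc : ∀ᶠ ε in 𝓝[>] (0 : ℝ), ε ∈ Ioc (0 : ℝ) 1 := Ioc_mem_nhdsGT one_pos
  have key : ∀ η > 0, ∀ᶠ ε in 𝓝[>] (0 : ℝ), ∀ t ∈ Icc 0 T,
      ‖toSobolev s (uε ε t) - toSobolev s (v t)‖ < η ∧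
      ‖toSobolev (s - 1) (uε ε t) - toSobolev (s - 1) (v t)‖ < η ∧
      ‖timeDeriv 1 (s - 1) (Icc 0 T) (uε ε) t - timeDeriv 1 (s - 1) (Icc 0 T) v t‖ < η := by
    intro η hη
    obtain ⟨δ, hδ, H⟩ := (hv.isLTwoSolution hT ha).stability hT ha (half_pos hη)
    filter_upwards [hIoc, haε, Metric.tendstoUniformlyOn_iff.mp hlim δ hδ] with ε hε hcε hd t ht
    have h0 := hv.besselEquiv_initial (hu ε hε)
    obtain ⟨h1, h2⟩ := H (aε ε) _ _ hcε ((hu ε hε).isLTwoSolution hT hcε) h0.1 h0.2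
      (fun τ hτ => by
        have := (hd τ hτ).le
        rwa [dist_comm, Real.dist_eq] at this) t ht
    -- The `H^(s-1)` norm is dominated by the `H^s` norm, since `J^(-1)` is a contraction.
    have h3 : ‖toSobolev (s - 1) (uε ε t) - toSobolev (s - 1) (v t)‖ ≤ η / 2 := by
      rw [← (besselEquiv n (s - 1)).norm_map, map_sub,
        besselEquiv_toSobolev_sub_one ((hu ε hε).memC0.1 t ht),
        besselEquiv_toSobolev_sub_one (hv.memC0.1 t ht), ← map_sub (besselInv n)]
      exact (norm_besselInv_le _).trans h1
    rw [← map_sub, LinearIsometryEquiv.norm_map] at h1 h2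
    exact ⟨h1.trans_lt (half_lt_self hη), h3.trans_lt (half_lt_self hη),
      h2.trans_lt (half_lt_self hη)⟩
  refine ⟨?_, ?_, ?_⟩ <;> rw [Metric.tendstoUniformlyOn_iff] <;> intro η hη <;>
    filter_upwards [key η hη] with ε h t ht <;> rw [dist_comm, dist_eq_norm]
  · exact (h t ht).1
  · exact (h t ht).2.1
  · exact (h t ht).2.2

end Solutions

end Sobolev

/-! ### Uniform convergence of the regularised coefficient -/

section Mollification

variable {ψ : ℝ → ℝ}

theorem IsMollifier.contDiff_scaled (hψ : IsMollifier ψ) (h : ℝ) :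
    ContDiff ℝ ∞ (fun t => h⁻¹ * ψ (t / h)) :=
  contDiff_const.mul (hψ.smooth.comp (contDiff_id.div_const h))

theorem IsMollifier.integral_scaled (hψ : IsMollifier ψ) {h : ℝ} (hh : 0 < h) :
    ∫ t, h⁻¹ * ψ (t / h) = 1 := by
  rw [integral_const_mul, Measure.integral_comp_div, hψ.integral_eq_one, abs_of_pos hh]
  simp [hh.ne']

theorem IsMollifier.exists_support_subset (hψ : IsMollifier ψ) :
    ∃ M : ℝ, 0 < M ∧ ∀ h : ℝ, 0 < h →
      tsupport (fun t => h⁻¹ * ψ (t / h)) ⊆ Metric.closedBall 0 (h * M) := by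
  obtain ⟨M, hM0, hM⟩ := hψ.compactSupport.isCompact.isBounded.subset_ball_lt 0 0
  refine ⟨M, hM0, fun h hh => closure_minimal (fun t ht => ?_) Metric.isClosed_closedBall⟩
  have h1 : t / h ∈ tsupport ψ := subset_tsupport ψ fun h0 => ht (by simp [h0])
  have h2 := hM h1
  rw [mem_ball_zero_iff, Real.norm_eq_abs, abs_div, abs_of_pos hh, div_lt_iff₀ hh] at h2
  rw [mem_closedBall_zero_iff, Real.norm_eq_abs, mul_comm]
  exact h2.le

theorem IsMollifier.hasCompactSupport_scaled (hψ : IsMollifier ψ) {h : ℝ} (hh : 0 < h) :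
    HasCompactSupport (fun t => h⁻¹ * ψ (t / h)) := by
  obtain ⟨M, -, hM⟩ := hψ.exists_support_subset
  exact (isCompact_closedBall 0 (h * M)).of_isClosed_subset (isClosed_tsupport _) (hM h hh)

theorem dist_mollification_le (hψ : IsMollifier ψ) {B : ℝ → ℝ} (hB : Continuous B) {h M t e : ℝ}
    (hh : 0 < h) (he : 0 ≤ e)
    (hM : tsupport (fun t => h⁻¹ * ψ (t / h)) ⊆ Metric.closedBall 0 (h * M))
    (hBt : ∀ x ∈ Metric.ball t (h * M + h), dist (B x) (B t) ≤ e) :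
    dist ((B ⋆[ContinuousLinearMap.mul ℝ ℝ, volume] (fun t => h⁻¹ * ψ (t / h))) t) (B t) ≤ e := by
  have hL : (ContinuousLinearMap.mul ℝ ℝ) = (ContinuousLinearMap.lsmul ℝ ℝ).flip := by
    ext; simp
  rw [hL, convolution_flip]
  -- The extra `h` turns the closed ball containing the support into an open one.
  refine dist_convolution_le he (R := h * M + h) ?_
    (fun x => mul_nonneg (inv_nonneg.mpr hh.le) (hψ.nonneg _)) (hψ.integral_scaled hh)
    hB.aestronglyMeasurable hBt
  exact (subset_tsupport _).trans (hM.trans (Metric.closedBall_subset_ball (by linarith)))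

theorem tendstoUniformlyOn_mollification (hψ : IsMollifier ψ) {B : ℝ → ℝ} (hB : Continuous B)
    {η : ℝ → ℝ} (hη : ∀ ε ∈ Ioc (0 : ℝ) 1, 0 < η ε) (hη0 : Tendsto η (𝓝[>] 0) (𝓝 0)) (T : ℝ) :
    TendstoUniformlyOn
      (fun ε => B ⋆[ContinuousLinearMap.mul ℝ ℝ, volume] (fun t => (η ε)⁻¹ * ψ (t / η ε)))
      B (𝓝[>] 0) (Icc 0 T) := by
  obtain ⟨M, hM0, hM⟩ := hψ.exists_support_subset
  rw [Metric.tendstoUniformlyOn_iff]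
  intro e he
  -- Near the end points the mollifier sees values of `B` outside `[0,T]`; a margin of `1` suffices
  -- once its width is below `1`.
  have huc := (isCompact_Icc (a := (-1 : ℝ)) (b := T + 1)).uniformContinuousOn_of_continuous
    hB.continuousOn
  obtain ⟨d, hd0, hd⟩ := Metric.uniformContinuousOn_iff.mp huc (e / 2) (half_pos he)
  have hlim : Tendsto (fun ε => η ε * M + η ε) (𝓝[>] 0) (𝓝 0) := by
    simpa using (hη0.mul_const M).add hη0
  filter_upwards [hlim.eventually_lt_const (lt_min hd0 one_pos), Ioc_mem_nhdsGT one_pos]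
    with ε hε1 hε t ht
  rw [dist_comm]
  refine (dist_mollification_le hψ hB (hη ε hε) (half_pos he).le (hM _ (hη ε hε))
    fun x hx => ?_).trans_lt (half_lt_self he)
  have hx' : dist x t < min d 1 := (Metric.mem_ball.mp hx).trans hε1
  have hx1 := abs_lt.mp (hx'.trans_le (min_le_right _ _))
  exact (hd x ⟨by linarith [hx1.1, ht.1], by linarith [hx1.2, ht.2]⟩ t
    ⟨by linarith [ht.1], by linarith [ht.2]⟩ (hx'.trans_le (min_le_left _ _))).le

/-- Differentiation first falls on the compactly supported factor and is then moved to `B` by an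
integration by parts without boundary terms. Thus `b_ε'` is the mollification of `B'`. -/
theorem deriv_convolution_eq {B ρ : ℝ → ℝ} (hB : ContDiff ℝ 1 B) (hρ : ContDiff ℝ 1 ρ)
    (hc : HasCompactSupport ρ) :
    deriv (B ⋆[ContinuousLinearMap.mul ℝ ℝ, volume] ρ) =
      deriv B ⋆[ContinuousLinearMap.mul ℝ ℝ, volume] ρ := by
  ext x
  rw [(hc.hasDerivAt_convolution_right (ContinuousLinearMap.mul ℝ ℝ)
    hB.continuous.locallyIntegrable hρ x).deriv]
  have hB' : Continuous (deriv B) := hB.continuous_deriv le_rfl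
  have hρ' : Continuous (deriv ρ) := hρ.continuous_deriv le_rfl
  have hcx : HasCompactSupport (fun t => ρ (x - t)) := hc.comp_homeomorph (Homeomorph.subLeft x)
  have hcx' : HasCompactSupport (fun t => deriv ρ (x - t)) :=
    hc.deriv.comp_homeomorph (Homeomorph.subLeft x)
  have hρx : Continuous (fun t => ρ (x - t)) := by have := hρ.continuous; fun_prop
  have hρx' : Continuous (fun t => deriv ρ (x - t)) := by fun_prop
  have := integral_mul_deriv_eq_deriv_mul_of_integrable (u := B) (u' := deriv B)
    (v := fun t => -ρ (x - t)) (v' := fun t => deriv ρ (x - t))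
    (fun t _ => (hB.differentiable one_ne_zero t).hasDerivAt)
    (fun t _ => by
      have h1 := (hρ.differentiable one_ne_zero (x - t)).hasDerivAt.scomp t
        ((hasDerivAt_id t).const_sub x)
      simpa using! h1.neg)
    ((hB.continuous.mul hρx').integrable_of_hasCompactSupport hcx'.mul_left)
    ((hB'.mul hρx.neg).integrable_of_hasCompactSupport (hcx.neg.mul_left))
    ((hB.continuous.mul hρx.neg).integrable_of_hasCompactSupport (hcx.neg.mul_left))
  simp only [convolution_def, ContinuousLinearMap.mul_apply']
  rw [this, ← integral_neg]
  simp

theorem IsModerateRegularisation.tendstoUniformlyOn_quotient {b : ℝ → ℝ} {bε : ℝ → ℝ → ℝ}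
    (h : IsModerateRegularisation b bε) {T : ℝ} :
    TendstoUniformlyOn (fun ε t => deriv (bε ε) t / bε ε t)
      (fun t => derivWithin b (Ici 0) t / b t) (𝓝[>] 0) (Icc 0 T) ∧
    ∀ᶠ ε in 𝓝[>] 0, ContinuousOn (fun t => deriv (bε ε) t / bε ε t) (Icc 0 T) := by
  obtain ⟨hmod, B, ψ, η, hB, hBb, ⟨c, hc, hcB⟩, hψ, hη, hη0, hbε⟩ := h
  have hIoc : ∀ᶠ ε in 𝓝[>] (0 : ℝ), ε ∈ Ioc (0 : ℝ) 1 := Ioc_mem_nhdsGT one_pos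
  have hB' : Continuous (deriv B) := hB.continuous_deriv le_rfl
  have h1 : TendstoUniformlyOn bε B (𝓝[>] 0) (Icc 0 T) :=
    (tendstoUniformlyOn_mollification hψ hB.continuous hη hη0 T).congr
      (by filter_upwards [hIoc] with ε hε t _; simp only [hbε ε hε])
  have h2 : TendstoUniformlyOn (fun ε => deriv (bε ε)) (deriv B) (𝓝[>] 0) (Icc 0 T) :=
    (tendstoUniformlyOn_mollification hψ hB' hη hη0 T).congr
      (by
        filter_upwards [hIoc] with ε hε t _
        simp only [hbε ε hε]
        rw [deriv_convolution_eq hB ((hψ.contDiff_scaled _).of_le (by simp))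
          (hψ.hasCompactSupport_scaled (hη ε hε))])
  have hBne : ∀ t, B t ≠ 0 := fun t => (hc.trans_le (hcB t)).ne'
  constructor
  · rw [← tendstoLocallyUniformlyOn_iff_tendstoUniformlyOn_of_compact isCompact_Icc] at h1 h2 ⊢
    -- On the compact interval locally uniform and uniform convergence coincide, and the former
    -- passes to quotients with continuous limits and nonvanishing limit denominator.
    refine (h2.div₀ h1 hB'.continuousOn hB.continuous.continuousOn
      (fun t _ => hBne t)).congr_right fun t ht => ?_
    have hd : derivWithin b (Ici 0) t = deriv B t := by
      rw [← derivWithin_congr hBb (hBb ht.1)]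
      exact (hB.differentiable one_ne_zero t).derivWithin (uniqueDiffOn_Ici 0 t ht.1)
    rw [Pi.div_apply, hd, hBb ht.1]
  -- Once `b_ε` is closer to `B` than its lower bound `c`, it cannot vanish on `[0,T]`.
  · filter_upwards [hIoc, Metric.tendstoUniformlyOn_iff.mp h1 c hc] with ε hε hd
    have hs := hmod.1 ε hε
    refine ContinuousOn.div (hs.continuous_deriv (by simp)).continuousOn hs.continuous.continuousOn
      fun t ht h0 => ?_
    have := hd t ht
    rw [h0, dist_zero_right, Real.norm_eq_abs, abs_of_pos (hc.trans_le (hcB t))] at this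
    exact this.not_ge (hcB t)

end Mollification

end DissipativeWave

end

theorem mainTheorem5 (n : ℕ) (hn : 1 ≤ n) (b : ℝ → ℝ) (b₀ b₀' : ℝ)
    (hb : ContDiffOn ℝ 1 b (Set.Ici 0)) (hmono : MonotoneOn b (Set.Ici 0))
    (hb₀ : 0 < b₀) (hb_lower : ∀ t ∈ Set.Ici (0 : ℝ), b₀ ≤ b t)
    (hb₀' : 0 < b₀') (hb'_lower : ∀ t ∈ Set.Ici (0 : ℝ), b₀' ≤ derivWithin b (Set.Ici 0) t)
    (s : ℝ) (u₀ u₁ : DissipativeWave.TempDist n)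
    (hu₀ : TemperedDistribution.MemSobolev s 2 u₀)
    (hu₁ : TemperedDistribution.MemSobolev (s - 1) 2 u₁) (T : ℝ) (hT : 0 < T) :
    ∃ v : ℝ → DissipativeWave.TempDist n,
      DissipativeWave.IsClassicalSolution b s u₀ u₁ T v ∧
      (∀ w : ℝ → DissipativeWave.TempDist n,
        DissipativeWave.IsClassicalSolution b s u₀ u₁ T w → Set.EqOn w v (Set.Icc 0 T)) ∧
      ∀ (bε : ℝ → ℝ → ℝ) (u : ℝ → ℝ → DissipativeWave.TempDist n),
        DissipativeWave.IsVeryWeakSolution b s u₀ u₁ bε u →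
          DissipativeWave.ConvergesInSobolev s T u v := by
  have ha : ContinuousOn (fun t => derivWithin b (Set.Ici 0) t / b t) (Set.Icc 0 T) :=
    ((hb.continuousOn_derivWithin (uniqueDiffOn_Ici 0) le_rfl).div hb.continuousOn
      fun t ht => (hb₀.trans_le (hb_lower t ht)).ne').mono Set.Icc_subset_Ici_self
  obtain ⟨v, hv⟩ := DissipativeWave.exists_isSobolevSolution hT ha hu₀ hu₁
  refine ⟨v, hv, fun w hw => hv.eqOn hT ha hw, fun bε u hu => ?_⟩
  obtain ⟨hlim, hcont⟩ := hu.regularisation.tendstoUniformlyOn_quotient (T := T)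
  exact DissipativeWave.convergesInSobolev_of_tendstoUniformlyOn hT ha hv hcont
    (fun ε hε => (hu.solves ε hε).restrict hT) hlim
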